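/- **Setting.** Let $\mathcal C\subseteq\mathbb R^d$ be an arbitrary nonempty closed convex set with Euclidean projection $\Pi_{\mathcal C}$. There are $N\ge 1$ agents. Agent $i$ holds data points $(z^i_j,l^i_j)\in\mathbb R^d\times\mathbb R$, $1\le j\le b_i$ ($b_i\ge1$), which define its local loss $$f_i(x)=\frac1{b_i}\sum_{j=1}^{b_i}\phi(\langle z^i_j,x\rangle,l^i_j),$$ where $\phi:\mathbb R\times\mathbb R\to\mathbb R$ is convex and differentiable in its first argument. Write $F=\sum_{i=1}^N f_i$. Let $m,M,L,C_2,B_2>0$, $\delta\in(0,1)$ and $0<\epsilon\le 1+\log(1/\delta)$. For each $i$ let $\mathcal F_i$ be a family of possible local data sets of agent $i$ such that * $\|z^i_j\|_2\le C_2$ for all $j$; $\phi(\cdot,l^i_j)$ is $L$-Lipschitz on $\{\langle z^i_j,x\rangle:x\in\mathcal C\}$; and $f_i$ is $m$-strongly convex and $M$-smooth on $\mathcal C$, that is, $m\|x-y\|^2\le\langle x-y,\nabla f_i(x)-\nabla f_i(y)\rangle$ and $\|\nabla f_i(x)-\nabla f_i(y)\|\le M\|x-y\|$ for $x,y\in\mathcal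 C$; * (local $l_2$-sensitivity) $\sup_{x\in\mathcal C}\|\nabla f_i(x)-\nabla\hat f_i(x)\|_2\le B_2$ for any two losses $f_i,\hat f_i$ from the family. **Algorithm.** From arbitrary initial vectors $x^0_1,\dots,x^0_N\in\mathbb R^d$, the agents run $K$ rounds of private decentralized gradient descent on the complete graph with step size $1/M$: with $p^k=\Pi_{\mathcal C}\big(\frac1N\sum_{j}x^k_j\big)$, agent $i$ broadcasts $$x_i^{k+1}=p^k-\tfrac1M\nabla f_i(p^k)+\Delta_i^{k+1},\qquad k=0,\dots,K-1,$$ where the $\Delta_i^{k+1}$ are independent with law $N(0,\sigma^2I_d)$. The final estimate is $p^K$. The algorithm is $(\epsilon,\delta)$-LDP if, for any two inputs from $\prod_i\mathcal F_i$ that differ only in the data of one agent and for every measurable set $S$ of transcripts, the transcript $X=(x_i^k)_{1\le i\le N,\,0\le k\le K}$ satisfies $\Pr[X\in S]\le e^{\epsilon}\Pr[X'\in S]+\delta$, where $X'$ is the transcript for the other input. **Theorem 4.1.** There are absolute constants $c$ and $p$ such that for all $N,m,M,L,C_2,B_2,\epsilon,\delta$ as above there are a number of rounds $K$ and a noise level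 $\sigma>0$, depending only on these constants (not on $d$, $\mathcal C$, $\phi$, the families, the data or the initialization), with which, for every $d$, $\mathcal C$, $\phi$, $(\mathcal F_i)$ and $(x^0_i)$ as above, the algorithm is $(\epsilon,\delta)$-LDP and, for every input from $\prod_i\mathcal F_i$ and every minimizer $x^*$ of $F$ over $\mathcal C$, $F(p^K)$ is integrable and $$\mathbb E\,F(p^K)-F(x^*)\;\le\; c\,\frac{\sqrt M\,N\,C_2\,L\,B_2}{m^{3/2}\,\epsilon}\;\log^p\!\Big(2+\frac Mm+\frac{L C_2}{B_2}+\frac1\delta\Big).$$ In particular the bound does not depend on $d$. -/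

import Mathlib

open MeasureTheory ProbabilityTheory

noncomputable section

namespace LDPOpt

/-- The parameter space `ℝ^d` with its Euclidean norm. -/
abbrev E (d : ℕ) : Type := EuclideanSpace ℝ (Fin d)

/-- The data held by one agent: `b ≥ 1` labelled points `(z_j, l_j) ∈ ℝ^d × ℝ`. -/
structure LocalData (d : ℕ) where
  b : ℕ
  b_pos : 0 < b
  z : Fin b → E d
  l : Fin b → ℝ

/-- The local generalized linear loss `f(x) = (1/b) ∑_j φ(⟨z_j, x⟩, l_j)`. -/
def glf {d : ℕ} (φ : ℝ → ℝ → ℝ) (P : LocalData d) (x : E d) : ℝ :=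
  (1 / (P.b : ℝ)) * ∑ j, φ (inner ℝ (P.z j) x) (P.l j)

/-- `m ‖x - y‖² ≤ (x - y)ᵀ (∇f(x) - ∇f(y))` on `C`. -/
def StrongConvexGradOn {d : ℕ} (m : ℝ) (C : Set (E d)) (f : E d → ℝ) : Prop :=
  ∀ x ∈ C, ∀ y ∈ C, m * ‖x - y‖ ^ 2 ≤ inner ℝ (x - y) (gradient f x - gradient f y)

/-- `‖∇f(x) - ∇f(y)‖ ≤ M ‖x - y‖` on `C`. -/
def SmoothGradOn {d : ℕ} (M : ℝ) (C : Set (E d)) (f : E d → ℝ) : Prop :=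
  ∀ x ∈ C, ∀ y ∈ C, ‖gradient f x - gradient f y‖ ≤ M * ‖x - y‖

/-- The assumptions on the data of one agent: the points are bounded by `C₂` in `l_2`, `φ(·, l_j)`
is `L`-Lipschitz on the values `⟨z_j, x⟩`, `x ∈ C`, that it is evaluated at, and the local loss is
`m`-strongly convex and `M`-smooth on `C`. -/
structure Admissible {d : ℕ} (φ : ℝ → ℝ → ℝ) (C : Set (E d)) (m M L C₂ : ℝ)
    (P : LocalData d) : Prop where
  norm_le : ∀ j, ‖P.z j‖ ≤ C₂
  lipschitz : ∀ j, ∀ x ∈ C, ∀ y ∈ C,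
    |φ (inner ℝ (P.z j) x) (P.l j) - φ (inner ℝ (P.z j) y) (P.l j)|
      ≤ L * |inner ℝ (P.z j) x - inner ℝ (P.z j) y|
  strongConvex : StrongConvexGradOn m C (glf φ P)
  smooth : SmoothGradOn M C (glf φ P)

/-- Local `l_2` sensitivity at most `B₂` on `C`, for the information that the algorithm releases
about the local losses, which is their gradients. -/
def SensitivityLE {d : ℕ} (φ : ℝ → ℝ → ℝ) (C : Set (E d)) (B₂ : ℝ)
    (𝓕 : Set (LocalData d)) : Prop :=
  ∀ P ∈ 𝓕, ∀ Q ∈ 𝓕, ∀ x ∈ C, ‖gradient (glf φ P) x - gradient (glf φ Q) x‖ ≤ B₂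

/-- Euclidean projection: a point of `C` nearest to `y` (it exists and is unique for nonempty closed
convex `C`). -/
def proj {d : ℕ} (C : Set (E d)) (y : E d) : E d :=
  Classical.epsilon fun p => p ∈ C ∧ ∀ q ∈ C, dist y p ≤ dist y q

theorem proj_spec {d : ℕ} {C : Set (E d)} (hne : C.Nonempty) (hC : IsClosed C) (y : E d) :
    proj C y ∈ C ∧ ∀ q ∈ C, dist y (proj C y) ≤ dist y q := by
  have h : ∃ p, p ∈ C ∧ ∀ q ∈ C, dist y p ≤ dist y q := by
    obtain ⟨p, hp, h⟩ := hC.exists_infDist_eq_dist hne y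
    exact ⟨p, hp, fun q hq => h ▸ Metric.infDist_le_dist_of_mem hq⟩
  exact Classical.epsilon_spec h

/-- The random aggregator of the algorithm, for the diagonal weight matrix with diagonal `w` and the
pair of agents `(a, b)`:
`(2w/N) x_a + (2(I - w)/N) x_b + (1/N) ∑_{j ≠ a, b} x_j`. -/
def aggregator {N d : ℕ} (w : Fin d → ℝ) (a b : Fin N) (x : Fin N → E d) : E d :=
  WithLp.toLp 2 fun t =>
    2 * w t / N * x a t + 2 * (1 - w t) / N * x b t
      + (∑ j ∈ Finset.univ.filter (fun j => j ≠ a ∧ j ≠ b), x j t) / N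

/-- The average `x̄ = (1/N) ∑_j x_j`. -/
def average {N d : ℕ} (x : Fin N → E d) : E d := (N : ℝ)⁻¹ • ∑ j, x j

/-- With all weights equal to `1/2` the aggregator is the average, whatever the pair is. -/
theorem aggregator_half {N d : ℕ} {a b : Fin N} (hab : a ≠ b) (x : Fin N → E d) :
    aggregator (fun _ => 1 / 2) a b x = average x := by
  ext t
  have h : ∑ j, x j t = x a t + x b t
      + ∑ j ∈ Finset.univ.filter (fun j => j ≠ a ∧ j ≠ b), x j t := by
    rw [← Finset.add_sum_erase _ _ (Finset.mem_univ a),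
      ← Finset.add_sum_erase _ _ (Finset.mem_erase.2 ⟨hab.symm, Finset.mem_univ b⟩), ← add_assoc]
    congr 2
    ext j
    simp [and_comm]
  simp only [aggregator, average, PiLp.smul_apply, WithLp.ofLp_sum, Finset.sum_apply, smul_eq_mul]
  rw [h]
  ring

/-- The average of the exchanged vectors, projected onto the constraint set. -/
def center {N d : ℕ} (C : Set (E d)) (x : Fin N → E d) : E d := proj C (average x)

/-- Private decentralized gradient descent under the constraint `C`, weights `1/2`: the vectors
`x_i^k` that the agents broadcast, as a function of the noise `Δ_i^{k+1} = Δ k i`: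
`x_i^{k+1} = p^k - η_{k+1} ∇f_i(p^k) + Δ_i^{k+1}` with `p^k` the projection of the average of
`x_1^k, …, x_N^k` (for `C = ℝ^d`, just the average). -/
def iterates {N d : ℕ} (C : Set (E d)) (η : ℕ → ℝ) (f : Fin N → E d → ℝ) (x₀ : Fin N → E d)
    (Δ : ℕ → Fin N → E d) : ℕ → Fin N → E d
  | 0 => x₀
  | k + 1 => fun i =>
      center C (iterates C η f x₀ Δ k)
        - η (k + 1) • gradient (f i) (center C (iterates C η f x₀ Δ k)) + Δ k i

/-- The centered Gaussian distribution `N(0, σ² I_d)`. -/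
def gaussianNoise (d : ℕ) (σ : ℝ) : Measure (E d) :=
  (stdGaussian (E d)).map fun g => σ • g

/-- The law of the noise: independent `N(0, σ² I_d)` vectors for all `K` rounds and `N` agents. -/
def noiseLaw (K N d : ℕ) (σ : ℝ) : Measure (Fin K → Fin N → E d) :=
  Measure.pi fun _ => Measure.pi fun _ => gaussianNoise d σ

/-- The noise of `K` rounds as a sequence (its values from index `K` on are never used). -/
def extend {K N d : ℕ} (Δ : Fin K → Fin N → E d) : ℕ → Fin N → E d :=
  fun k => if h : k < K then Δ ⟨k, h⟩ else 0

/-- Everything that is exchanged: `x_i^k` for all agents `i` and `k = 0, …, K`. -/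
def transcript {K N d : ℕ} (C : Set (E d)) (η : ℕ → ℝ) (φ : ℝ → ℝ → ℝ) (x₀ : Fin N → E d)
    (D : Fin N → LocalData d) (Δ : Fin K → Fin N → E d) : Fin (K + 1) → Fin N → E d :=
  fun k => iterates C η (fun i => glf φ (D i)) x₀ (extend Δ) k

/-- The final estimate: the projected average of the last exchanged vectors. -/
def finalEstimate {K N d : ℕ} (C : Set (E d)) (η : ℕ → ℝ) (φ : ℝ → ℝ → ℝ) (x₀ : Fin N → E d)
    (D : Fin N → LocalData d) (Δ : Fin K → Fin N → E d) : E d :=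
  center C (transcript C η φ x₀ D Δ (Fin.last K))

/-- `(ε, δ)`-local differential privacy of the randomized output `out D` (randomness `ω ∼ μ`): for any
two inputs from the given local families which differ only in the input of one agent. -/
def IsLDP {N : ℕ} {T Ω X : Type} [MeasurableSpace Ω] [MeasurableSpace X] (μ : Measure Ω)
    (out : (Fin N → T) → Ω → X) (𝓕 : Fin N → Set T) (ε δ : ℝ) : Prop :=
  ∀ D D' : Fin N → T, (∀ i, D i ∈ 𝓕 i) → (∀ i, D' i ∈ 𝓕 i) →
    ∀ i, (∀ j, j ≠ i → D j = D' j) → ∀ S : Set X, MeasurableSet S →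
      μ {ω | out D ω ∈ S} ≤
        ENNReal.ofReal (Real.exp ε) * μ {ω | out D' ω ∈ S} + ENNReal.ofReal δ

/-- The total objective `F(x) = ∑_i f_i(x)`. -/
def objective {N d : ℕ} (φ : ℝ → ℝ → ℝ) (D : Fin N → LocalData d) (x : E d) : ℝ :=
  ∑ i, glf φ (D i) x

end LDPOpt

end

/-! Privacy comes from the Gaussian mechanism. Changing the data of one agent shifts its message in
each round by at most `B₂ / M`, so `K` adaptive rounds need `σ` of order `(B₂ / (M ε)) √(K
log(1/δ))`. The composition is a Rényi-type estimate in the form of Hölder's inequality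
(`LebesgueBound.pi`), converted to `(ε, δ)` by `le_exp_mul_add_of_le_rpow`.

Accuracy must not see `d`, although the noise has norm about `σ √d`. In the regret inequality of one
projected step (`objective_step_sub_le`) the noise enters only through `⟪Δ_i, p^{k+1} - u⟫` with `u`
determined by the past, that is, through the correlation of a Gaussian vector with the projection of
a translate of it. For `X(g) = Π(y + s g)`, `g` standard Gaussian, `integral_inner_proj_le` bounds
this correlation by `L C₂ / m`. Indeed `X` is the gradient of a convex function, so `DX` is
symmetric and positive semidefinite. By strong convexity `V = ∇f(X) - m X` is a monotone function of
`X`, which forces `tr DV ≥ 0`. Gaussian integration by parts then yields `m E⟪g, X⟫ ≤ E⟪g, ∇f(X)⟫`.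
Finally `∇f` is an average of vectors `φ' z_j` with `|φ'| ≤ L` up to constants, so the right side is
at most `L max_j E|⟪z_j, g⟫| ≤ L C₂`.

Each round thus costs every agent `e = M σ L C₂ / m`. Strong convexity forgets the start at rate `1
- m/M`, and comparing the iterates with earlier ones (`last_iterate_le`) transfers the bound to the
last iterate at the price of a logarithm. With `K` of order `(M/m) log Q`, `Q` being the argument of
the logarithm in the bound, `e` is `√M L C₂ B₂ / (m^{3/2} ε)` up to logarithms. -/

namespace LDPOpt

open Filter Topology

/-! ### Projection onto a convex set as the gradient of a convex potential. -/

section Projection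

variable {d : ℕ} {C : Set (E d)}

theorem inner_sub_proj_nonpos (hne : C.Nonempty) (hC : IsClosed C) (hconv : Convex ℝ C)
    (y : E d) {q : E d} (hq : q ∈ C) : inner ℝ (y - proj C y) (q - proj C y) ≤ 0 := by
  obtain ⟨hp, hmin⟩ := proj_spec hne hC y
  refine (norm_eq_iInf_iff_real_inner_le_zero hconv hp).1 ?_ q hq
  have : Nonempty C := hne.to_subtype
  refine le_antisymm (le_ciInf fun w => ?_) ?_
  · simpa [dist_eq_norm] using hmin w w.2
  · exact ciInf_le ⟨0, by rintro _ ⟨w, rfl⟩; exact norm_nonneg _⟩ (⟨proj C y, hp⟩ : C)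

theorem norm_proj_sub_sq_le (hne : C.Nonempty) (hC : IsClosed C) (hconv : Convex ℝ C)
    (a b : E d) : ‖proj C a - proj C b‖ ^ 2 ≤ inner ℝ (a - b) (proj C a - proj C b) := by
  have h1 := inner_sub_proj_nonpos hne hC hconv a (proj_spec hne hC b).1
  have h2 := inner_sub_proj_nonpos hne hC hconv b (proj_spec hne hC a).1
  rw [← real_inner_self_eq_norm_sq]
  simp only [inner_sub_left, inner_sub_right] at *
  linarith

theorem norm_proj_sub_le (hne : C.Nonempty) (hC : IsClosed C) (hconv : Convex ℝ C)
    (a b : E d) : ‖proj C a - proj C b‖ ≤ ‖a - b‖ := by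
  have h := (norm_proj_sub_sq_le hne hC hconv a b).trans (real_inner_le_norm _ _)
  by_contra! hlt
  nlinarith [norm_nonneg (a - b), norm_nonneg (proj C a - proj C b)]

theorem continuous_proj (hne : C.Nonempty) (hC : IsClosed C) (hconv : Convex ℝ C) :
    Continuous (proj C) :=
  (LipschitzWith.of_dist_le_mul (K := 1) fun a b => by
    simpa [dist_eq_norm] using norm_proj_sub_le hne hC hconv a b).continuous

/-- The convex potential of which the projection is the gradient. -/
noncomputable def projPotential (C : Set (E d)) (v : E d) : ℝ :=
  inner ℝ v (proj C v) - ‖proj C v‖ ^ 2 / 2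

/-- The potential is the supremum over `q ∈ C` of the affine functions `⟪v, q⟫ - ‖q‖²/2`, attained
at the projection. So the projection is a subgradient at `v` and at `v + h`, and the remainder lies
between `0` and `⟪h, proj C (v + h) - proj C v⟫ ≤ ‖h‖²`. -/
theorem hasFDerivAt_projPotential (hne : C.Nonempty) (hC : IsClosed C) (hconv : Convex ℝ C)
    (v : E d) : HasFDerivAt (projPotential C) (innerSL ℝ (proj C v)) v := by
  rw [hasFDerivAt_iff_isLittleO_nhds_zero]
  refine Asymptotics.IsBigO.trans_isLittleO (g := fun h : E d => ‖h‖ ^ 2) ?_ ?_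
  · refine Asymptotics.IsBigO.of_bound 1 (Eventually.of_forall fun h => ?_)
    have h1 := inner_sub_proj_nonpos hne hC hconv v (proj_spec hne hC (v + h)).1
    have h2 := inner_sub_proj_nonpos hne hC hconv (v + h) (proj_spec hne hC v).1
    have h3 := norm_proj_sub_le hne hC hconv (v + h) v
    have h5 := real_inner_le_norm h (proj C (v + h) - proj C v)
    rw [add_sub_cancel_left] at h3
    have h4 : ‖h‖ * ‖proj C (v + h) - proj C v‖ ≤ ‖h‖ ^ 2 := by
      nlinarith [norm_nonneg h]
    have e : ‖proj C (v + h) - proj C v‖ ^ 2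
        = inner ℝ (proj C (v + h) - proj C v) (proj C (v + h) - proj C v) :=
      (real_inner_self_eq_norm_sq _).symm
    have hn := sq_nonneg ‖proj C (v + h) - proj C v‖
    rw [e] at hn
    simp only [projPotential, innerSL_apply_apply, Real.norm_eq_abs, one_mul,
      abs_of_nonneg (sq_nonneg ‖h‖)]
    rw [abs_le]
    simp only [← real_inner_self_eq_norm_sq] at *
    simp only [inner_sub_left, inner_sub_right, inner_add_left] at *
    rw [real_inner_comm (proj C v) (proj C (v + h)), real_inner_comm h (proj C v)] at *
    constructor <;> nlinarith
  · exact Asymptotics.isLittleO_norm_pow_id one_lt_two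

end Projection

/-- A map that has a potential has symmetric derivatives. -/
theorem inner_deriv_symm_of_potential {d : ℕ} {X : E d → E d} {θ : E d → ℝ}
    (hθ : ∀ v, HasFDerivAt θ (innerSL ℝ (X v)) v) {B : E d →L[ℝ] E d} {x : E d}
    (hB : HasFDerivAt X B x) (u w : E d) : inner ℝ (B u) w = inner ℝ u (B w) := by
  have h : HasFDerivAt (fun v => innerSL ℝ (X v)) ((innerSL ℝ).comp B) x :=
    (innerSL ℝ).hasFDerivAt.comp x hB
  have := second_derivative_symmetric hθ h u w
  simp only [ContinuousLinearMap.comp_apply, innerSL_apply_apply] at this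
  rw [this, real_inner_comm]

/-! ### Moments of the standard Gaussian and the trace inequality. -/

section Gaussian

variable {d : ℕ}

theorem integrable_norm_stdGaussian : Integrable (fun g : E d => ‖g‖) (stdGaussian (E d)) :=
  IsGaussian.integrable_id.norm

theorem integrable_norm_sq_stdGaussian :
    Integrable (fun g : E d => ‖g‖ ^ 2) (stdGaussian (E d)) :=
  (IsGaussian.memLp_two_id (μ := stdGaussian (E d))).integrable_norm_pow two_ne_zero

theorem integral_inner_mul_inner_stdGaussian (a b : E d) :
    ∫ g, inner ℝ a g * inner ℝ b g ∂(stdGaussian (E d)) = inner ℝ a b := by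
  have h := covarianceBilin_apply (μ := stdGaussian (E d)) IsGaussian.memLp_two_id a b
  rw [covarianceBilin_stdGaussian] at h
  simpa [innerSL_apply_apply ℝ] using h.symm

theorem integrable_inner_mul_inner_stdGaussian (a b : E d) :
    Integrable (fun g => inner ℝ a g * inner ℝ b g) (stdGaussian (E d)) := by
  refine (integrable_norm_sq_stdGaussian.const_mul (‖a‖ * ‖b‖)).mono'
    (by fun_prop) (Eventually.of_forall fun g => ?_)
  rw [norm_mul]
  have h1 := norm_inner_le_norm (𝕜 := ℝ) a g
  have h2 := norm_inner_le_norm (𝕜 := ℝ) b g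
  calc _ ≤ (‖a‖ * ‖g‖) * (‖b‖ * ‖g‖) := by gcongr
    _ = _ := by ring

/-- Integrate `|t| ≤ t² / (2‖z‖) + ‖z‖ / 2` at `t = ⟪z, g⟫`, which has variance `‖z‖²`. Only a
one-dimensional marginal matters, hence no `d`. -/
theorem integral_abs_inner_stdGaussian_le (z : E d) :
    ∫ g, |inner ℝ z g| ∂(stdGaussian (E d)) ≤ ‖z‖ := by
  rcases eq_or_ne z 0 with rfl | hz
  · simp
  have hz' : 0 < ‖z‖ := norm_pos_iff.2 hz
  have hi := integrable_inner_mul_inner_stdGaussian (d := d) z z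
  calc ∫ g, |inner ℝ z g| ∂(stdGaussian (E d))
      ≤ ∫ g, ((2 * ‖z‖)⁻¹ * (inner ℝ z g * inner ℝ z g) + ‖z‖ / 2) ∂(stdGaussian (E d)) := by
        refine integral_mono_of_nonneg (Eventually.of_forall fun g => abs_nonneg _)
          ((hi.const_mul _).add (integrable_const _)) (Eventually.of_forall fun g => ?_)
        have h := sq_nonneg (|inner ℝ z g| - ‖z‖)
        have h2 := sq_abs (inner ℝ z g : ℝ)
        have : (2 * ‖z‖)⁻¹ * (inner ℝ z g * inner ℝ z g) + ‖z‖ / 2 - |inner ℝ z g|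
            = (2 * ‖z‖)⁻¹ * (|inner ℝ z g| - ‖z‖) ^ 2 := by
          field_simp
          nlinarith
        have h3 : 0 ≤ (2 * ‖z‖)⁻¹ * (|inner ℝ z g| - ‖z‖) ^ 2 := by positivity
        simp only
        linarith
    _ = ‖z‖ := by
        rw [integral_add (hi.const_mul _) (integrable_const _), integral_const_mul,
          integral_inner_mul_inner_stdGaussian, real_inner_self_eq_norm_sq]
        simp
        field_simp
        norm_num

theorem pi_absolutelyContinuous {n : ℕ} {α : Type*} [MeasurableSpace α] {μ ν : Measure α}
    [SigmaFinite μ] [SigmaFinite ν] (h : μ ≪ ν) :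
    Measure.pi (fun _ : Fin n => μ) ≪ Measure.pi (fun _ : Fin n => ν) := by
  induction n with
  | zero => rw [Measure.pi_of_empty, Measure.pi_of_empty]
  | succ n ih =>
    have h1 := (measurePreserving_piFinSuccAbove (fun _ : Fin (n + 1) => μ) 0).symm
    have h2 := (measurePreserving_piFinSuccAbove (fun _ : Fin (n + 1) => ν) 0).symm
    rw [← h1.map_eq, ← h2.map_eq]
    exact (h.prod ih).map h1.measurable

/-- Carries Rademacher's theorem over from Lebesgue measure to the Gaussian. -/
theorem stdGaussian_absolutelyContinuous : stdGaussian (E d) ≪ (volume : Measure (E d)) := by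
  rw [← map_pi_eq_stdGaussian, ← (PiLp.volume_preserving_toLp (Fin d)).map_eq]
  exact (pi_absolutelyContinuous (gaussianReal_absolutelyContinuous 0 one_ne_zero)).map
    (by fun_prop)

/-- The quadratic form of a composition of monotone linear maps, one of them symmetric, has a
nonnegative Gaussian mean. -/
theorem integral_inner_clm_nonneg {A B : E d →L[ℝ] E d}
    (hsymm : ∀ u w, inner ℝ (B u) w = inner ℝ u (B w)) (hpos : ∀ u, 0 ≤ inner ℝ u (B u))
    (hmono : ∀ u, 0 ≤ inner ℝ (B u) (A u)) (hker : ∀ u, B u = 0 → A u = 0) :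
    0 ≤ ∫ u, inner ℝ u (A u) ∂(stdGaussian (E d)) := by
  have hS : (B : E d →ₗ[ℝ] E d).IsSymmetric := fun u w => hsymm u w
  have hn : Module.finrank ℝ (E d) = d := by simp
  -- The Gaussian mean of `⟪u, A u⟫` is the trace of `A`, computed here in an eigenbasis of `B`. For
  -- an eigenvalue `λ` of `b i`, `λ ⟪b i, A (b i)⟫ = ⟪B (b i), A (b i)⟫ ≥ 0` fixes the sign of the
  -- diagonal entry if `λ > 0`; if `λ = 0` the entry vanishes by `hker`.
  set b := hS.eigenvectorBasis hn
  have hb : ∀ i, B (b i) = (hS.eigenvalues hn i) • b i := fun i =>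
    hS.apply_eigenvectorBasis hn i
  have key : ∀ u : E d, inner ℝ u (A u)
      = ∑ i, ∑ j, inner ℝ (b i) (A (b j)) * (inner ℝ (b i) u * inner ℝ (b j) u) := by
    intro u
    have hA : A u = ∑ j, inner ℝ (b j) u • A (b j) := by
      conv_lhs => rw [← b.sum_repr' u]
      simp only [map_sum, map_smul]
    rw [← b.sum_inner_mul_inner u (A u)]
    refine Finset.sum_congr rfl fun i _ => ?_
    rw [hA, inner_sum, Finset.mul_sum]
    refine Finset.sum_congr rfl fun j _ => ?_
    rw [real_inner_smul_right, real_inner_comm]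
    ring
  simp_rw [key]
  have hint := fun i j => (integrable_inner_mul_inner_stdGaussian (b i) (b j)).const_mul
    (inner ℝ (b i) (A (b j)))
  rw [integral_finsetSum _ fun i _ => integrable_finsetSum _ fun j _ => hint i j]
  refine Finset.sum_nonneg fun i _ => ?_
  rw [integral_finsetSum _ fun j _ => hint i j, Finset.sum_eq_single i]
  · rw [integral_const_mul, integral_inner_mul_inner_stdGaussian]
    have h1 := hpos (b i)
    have h2 := hmono (b i)
    rw [hb, real_inner_smul_right, real_inner_self_eq_norm_sq, b.norm_eq_one] at h1
    rw [hb, real_inner_smul_left] at h2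
    rw [real_inner_self_eq_norm_sq, b.norm_eq_one]
    rcases (show 0 ≤ hS.eigenvalues hn i by simpa using h1).eq_or_lt with h0 | h0
    · rw [hker (b i) (by rw [hb, ← h0, zero_smul])]
      simp
    · simpa using nonneg_of_mul_nonneg_right h2 h0
  · intro j _ hj
    rw [integral_const_mul, integral_inner_mul_inner_stdGaussian, b.inner_eq_zero hj.symm, mul_zero]
  · simp

end Gaussian

end LDPOpt

namespace LDPOpt

open Filter Topology

/-! ### Gaussian integration by parts for Lipschitz maps, by rotation. -/

section Stein

variable {d : ℕ}

theorem norm_le_of_lipschitz {V : E d → E d} {κ : NNReal} (hV : LipschitzWith κ V) (g : E d) :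
    ‖V g‖ ≤ ‖V 0‖ + κ * ‖g‖ := by
  have h := hV.dist_le_mul g 0
  rw [dist_eq_norm, dist_zero_right] at h
  have := norm_sub_norm_le (V g) (V 0)
  linarith

theorem integrable_norm_of_lipschitz {V : E d → E d} {κ : NNReal} (hV : LipschitzWith κ V) :
    Integrable (fun g => ‖V g‖) (stdGaussian (E d)) :=
  ((integrable_const ‖V 0‖).add (integrable_norm_stdGaussian.const_mul (κ : ℝ))).mono'
    hV.continuous.norm.aestronglyMeasurable
    (Eventually.of_forall fun g => by simpa using norm_le_of_lipschitz hV g)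

theorem integrable_inner_of_lipschitz {V : E d → E d} {κ : NNReal} (hV : LipschitzWith κ V) :
    Integrable (fun g => inner ℝ g (V g)) (stdGaussian (E d)) := by
  refine ((integrable_norm_stdGaussian.const_mul ‖V 0‖).add
    (integrable_norm_sq_stdGaussian.const_mul (κ : ℝ))).mono'
    (continuous_id.inner hV.continuous).aestronglyMeasurable
    (Eventually.of_forall fun g => ?_)
  have h1 := norm_inner_le_norm (𝕜 := ℝ) g (V g)
  have h2 := mul_le_mul_of_nonneg_left (norm_le_of_lipschitz hV g) (norm_nonneg g)
  simp only [Pi.add_apply]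
  nlinarith

theorem integrable_inner_prod_of_lipschitz {V : E d → E d} {κ : NNReal} (hV : LipschitzWith κ V) :
    Integrable (fun p : E d × E d => inner ℝ p.2 (V p.1))
      ((stdGaussian (E d)).prod (stdGaussian (E d))) := by
  refine ((integrable_norm_of_lipschitz hV).mul_prod integrable_norm_stdGaussian).mono'
    (continuous_snd.inner (hV.continuous.comp continuous_fst)).aestronglyMeasurable
    (Eventually.of_forall fun p => ?_)
  rw [mul_comm]
  exact norm_inner_le_norm (𝕜 := ℝ) p.2 (V p.1)

theorem integral_inner_stdGaussian_eq_zero (a : E d) :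
    ∫ g, inner ℝ g a ∂(stdGaussian (E d)) = 0 := by
  have h := integral_strongDual_stdGaussian (innerSL ℝ a)
  simpa [innerSL_apply_apply ℝ, real_inner_comm a] using h

theorem integral_inner_prod_of_lipschitz {V : E d → E d} {κ : NNReal} (hV : LipschitzWith κ V) :
    ∫ p : E d × E d, inner ℝ p.2 (V p.1) ∂((stdGaussian (E d)).prod (stdGaussian (E d))) = 0 := by
  rw [integral_prod _ (integrable_inner_prod_of_lipschitz hV)]
  simp [integral_inner_stdGaussian_eq_zero]

theorem measurePreserving_rotation (t : ℝ) :
    MeasurePreserving (ContinuousLinearMap.rotation (E := E d) t)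
      ((stdGaussian (E d)).prod (stdGaussian (E d)))
      ((stdGaussian (E d)).prod (stdGaussian (E d))) :=
  ⟨(ContinuousLinearMap.rotation t).continuous.measurable,
    IsGaussian.map_rotation_eq_self (by simp) t⟩

/-- Let `q` be the rotated pair. It has the law of `p`, its first entry is the argument of `V`, and
`p.2 = sin t • q.1 + cos t • q.2`. The part along `q.2` is independent of `V q.1` and has mean zero.
-/
theorem integral_inner_rotation_sub {V : E d → E d} {κ : NNReal} (hV : LipschitzWith κ V)
    (t : ℝ) :
    ∫ p : E d × E d, inner ℝ p.2 (V (Real.cos t • p.1 + Real.sin t • p.2) - V p.1)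
        ∂((stdGaussian (E d)).prod (stdGaussian (E d)))
      = Real.sin t * ∫ g, inner ℝ g (V g) ∂(stdGaussian (E d)) := by
  set γ := stdGaussian (E d)
  have hR := measurePreserving_rotation (d := d) t
  let G : E d × E d → ℝ := fun q => Real.sin t * inner ℝ q.1 (V q.1)
    + Real.cos t * inner ℝ q.2 (V q.1)
  have i1 : Integrable (fun q : E d × E d => inner ℝ q.1 (V q.1)) (γ.prod γ) :=
    (integrable_inner_of_lipschitz hV).comp_fst γ
  have i2 := integrable_inner_prod_of_lipschitz hV
  have hG : Integrable G (γ.prod γ) := (i1.const_mul _).add (i2.const_mul _)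
  have hcomp : ∀ p : E d × E d, inner ℝ p.2 (V (Real.cos t • p.1 + Real.sin t • p.2))
      = G (ContinuousLinearMap.rotation t p) := by
    intro p
    simp only [G, ContinuousLinearMap.rotation_apply]
    rw [← real_inner_smul_left, ← real_inner_smul_left, ← inner_add_left]
    congr 1
    simp only [smul_add, smul_smul]
    have h1 := Real.sin_sq_add_cos_sq t
    have e1 : Real.sin t * Real.sin t + Real.cos t * Real.cos t = 1 := by linarith
    calc p.2 = (Real.sin t * Real.cos t + Real.cos t * -Real.sin t) • p.1
        + (Real.sin t * Real.sin t + Real.cos t * Real.cos t) • p.2 := by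
          rw [e1, show Real.sin t * Real.cos t + Real.cos t * -Real.sin t = 0 by ring]; simp
      _ = _ := by simp only [add_smul]; abel
  have hGint : ∫ q, G q ∂(γ.prod γ) = Real.sin t * ∫ g, inner ℝ g (V g) ∂γ := by
    rw [integral_add (i1.const_mul _) (i2.const_mul _), integral_const_mul, integral_const_mul,
      integral_inner_prod_of_lipschitz hV, mul_zero, add_zero]
    congr 1
    exact integral_fun_fst (fun g : E d => (inner ℝ g (V g) : ℝ)) |>.trans (by simp)
  have hmap : ∫ p, G (ContinuousLinearMap.rotation t p) ∂(γ.prod γ) = ∫ q, G q ∂(γ.prod γ) := by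
    conv_rhs => rw [← hR.map_eq]
    rw [integral_map hR.measurable.aemeasurable]
    rw [hR.map_eq]
    exact hG.aestronglyMeasurable
  simp_rw [inner_sub_right, hcomp]
  have hGR : Integrable (fun p => G (ContinuousLinearMap.rotation t p)) (γ.prod γ) :=
    hR.integrable_comp_of_integrable hG
  rw [integral_sub hGR i2,
    integral_inner_prod_of_lipschitz hV, sub_zero, hmap, hGint]

/-- A bound uniform in `t`, to dominate the limit `t → 0` under the integral. -/
theorem abs_inner_rotation_sub_le {V : E d → E d} {κ : NNReal} (hV : LipschitzWith κ V)
    (t : ℝ) (p : E d × E d) :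
    ‖t⁻¹ * inner ℝ p.2 (V (Real.cos t • p.1 + Real.sin t • p.2) - V p.1)‖
      ≤ κ * (‖p.1‖ * ‖p.2‖) + κ * ‖p.2‖ ^ 2 := by
  rcases eq_or_ne t 0 with rfl | ht
  · simp; positivity
  have ht' : 0 < |t| := abs_pos.2 ht
  have h1 := norm_inner_le_norm (𝕜 := ℝ) p.2 (V (Real.cos t • p.1 + Real.sin t • p.2) - V p.1)
  have h2 := hV.dist_le_mul (Real.cos t • p.1 + Real.sin t • p.2) p.1
  rw [dist_eq_norm, dist_eq_norm] at h2
  have h3 : ‖Real.cos t • p.1 + Real.sin t • p.2 - p.1‖ ≤ |t| * (‖p.1‖ + ‖p.2‖) := by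
    have e : Real.cos t • p.1 + Real.sin t • p.2 - p.1
        = (Real.cos t - 1) • p.1 + Real.sin t • p.2 := by rw [sub_smul, one_smul]; abel
    rw [e]
    refine (norm_add_le _ _).trans ?_
    rw [norm_smul, norm_smul, Real.norm_eq_abs, Real.norm_eq_abs, mul_add]
    have hs : |Real.sin t| ≤ |t| := Real.abs_sin_le_abs
    have hc : |Real.cos t - 1| ≤ |t| := by
      rw [abs_sub_comm, abs_of_nonneg (by linarith [Real.cos_le_one t])]
      rcases le_total |t| 2 with h | h
      · have := Real.one_sub_sq_div_two_le_cos (x := t)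
        nlinarith [sq_abs t]
      · linarith [Real.neg_one_le_cos t]
    gcongr
  rw [norm_mul, norm_inv, Real.norm_eq_abs t]
  calc |t|⁻¹ * ‖(inner ℝ p.2 (V (Real.cos t • p.1 + Real.sin t • p.2) - V p.1) : ℝ)‖
      ≤ |t|⁻¹ * (‖p.2‖ * (κ * (|t| * (‖p.1‖ + ‖p.2‖)))) := by
        gcongr
        refine h1.trans ?_
        gcongr
        exact h2.trans (by gcongr)
    _ = _ := by field_simp

theorem tendsto_line_of_hasFDerivAt {V : E d → E d} {A : E d →L[ℝ] E d} {x : E d}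
    (h : HasFDerivAt V A x) (u : E d) :
    Tendsto (fun t : ℝ => t⁻¹ • (V (x + t • u) - V x)) (𝓝[≠] 0) (𝓝 (A u)) :=
  (h.hasLineDerivAt u).tendsto_slope_zero

/-- A Gaussian integration by parts inequality: if `X` is Lipschitz, monotone and has a potential,
and `V` is a monotone and Lipschitz function of `X`, then `E⟪g, V g⟫ ≥ 0`. -/
theorem integral_inner_nonneg_of_monotone {V X : E d → E d} {κ κ' c : NNReal} {θ : E d → ℝ}
    (hV : LipschitzWith κ V) (hX : LipschitzWith κ' X)
    (hθ : ∀ v, HasFDerivAt θ (innerSL ℝ (X v)) v)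
    (hXmono : ∀ a b, 0 ≤ inner ℝ (a - b) (X a - X b))
    (hmono : ∀ a b, 0 ≤ inner ℝ (X a - X b) (V a - V b))
    (hdom : ∀ a b, ‖V a - V b‖ ≤ c * ‖X a - X b‖) :
    0 ≤ ∫ g, inner ℝ g (V g) ∂(stdGaussian (E d)) := by
  set γ := stdGaussian (E d)
  set I := ∫ g, inner ℝ g (V g) ∂γ
  have hae : ∀ᵐ g ∂γ, DifferentiableAt ℝ V g ∧ DifferentiableAt ℝ X g := by
    have h1 := stdGaussian_absolutelyContinuous.ae_le hV.ae_differentiableAt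
    have h2 := stdGaussian_absolutelyContinuous.ae_le hX.ae_differentiableAt
    filter_upwards [h1, h2] with g a b using ⟨a, b⟩
  have hae' : ∀ᵐ p ∂(γ.prod γ), DifferentiableAt ℝ V p.1 :=
    Measure.quasiMeasurePreserving_fst.ae (hae.mono fun _ h => h.1)
  let Fn : ℝ → E d × E d → ℝ := fun t p =>
    t⁻¹ * inner ℝ p.2 (V (Real.cos t • p.1 + Real.sin t • p.2) - V p.1)
  let D : E d × E d → ℝ := fun p => inner ℝ p.2 (fderiv ℝ V p.1 p.2)
  let bd : E d × E d → ℝ := fun p => κ * (‖p.1‖ * ‖p.2‖) + κ * ‖p.2‖ ^ 2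
  have hbd : Integrable bd (γ.prod γ) := by
    refine ((integrable_norm_stdGaussian.mul_prod integrable_norm_stdGaussian).const_mul _).add
      (Integrable.const_mul ?_ _)
    exact integrable_norm_sq_stdGaussian.comp_snd γ
  have hFm : ∀ t, AEStronglyMeasurable (Fn t) (γ.prod γ) := by
    intro t
    have := hV.continuous
    exact (by fun_prop : Continuous (Fn t)).aestronglyMeasurable
  have hlim : ∀ᵐ p ∂(γ.prod γ), Tendsto (fun t => Fn t p) (𝓝[≠] 0) (𝓝 (D p)) := by
    filter_upwards [hae'] with p hp
    have hcurve : HasDerivAt (fun t : ℝ => Real.cos t • p.1 + Real.sin t • p.2) p.2 0 := by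
      have := ((Real.hasDerivAt_cos 0).smul_const p.1).fun_add ((Real.hasDerivAt_sin 0).smul_const p.2)
      simpa using this
    have hc : HasDerivAt (fun t : ℝ => V (Real.cos t • p.1 + Real.sin t • p.2))
        (fderiv ℝ V p.1 p.2) 0 := by
      refine HasFDerivAt.comp_hasDerivAt (0 : ℝ) ?_ hcurve
      simpa using hp.hasFDerivAt
    have h := hc.tendsto_slope_zero
    have h2 := (tendsto_const_nhds (x := p.2)).inner (𝕜 := ℝ) h
    simpa [Fn, D, real_inner_smul_right] using h2
  have hDm : AEStronglyMeasurable D (γ.prod γ) :=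
    aestronglyMeasurable_of_tendsto_ae (𝓝[≠] (0 : ℝ)) hFm hlim
  have hDi : Integrable D (γ.prod γ) := by
    refine hbd.mono' hDm ?_
    filter_upwards [hlim] with p hp
    exact le_of_tendsto hp.norm (Eventually.of_forall fun t => abs_inner_rotation_sub_le hV t p)
  -- `h1` and `h2` compute one limit in two ways: as the mean of `⟪u, DV(g) u⟫` with `u` independent
  -- of `g`, and, by rotation invariance, as the mean of `⟪g, V g⟫`. Differentiability almost
  -- everywhere suffices.
  have h1 : Tendsto (fun t => ∫ p, Fn t p ∂(γ.prod γ)) (𝓝[≠] 0) (𝓝 (∫ p, D p ∂(γ.prod γ))) :=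
    tendsto_integral_filter_of_dominated_convergence bd (Eventually.of_forall hFm)
      (Eventually.of_forall fun t => Eventually.of_forall fun p =>
        abs_inner_rotation_sub_le hV t p) hbd hlim
  have h2 : Tendsto (fun t => ∫ p, Fn t p ∂(γ.prod γ)) (𝓝[≠] 0) (𝓝 I) := by
    have hs : Tendsto (fun t : ℝ => t⁻¹ • (Real.sin (0 + t) - Real.sin 0)) (𝓝[≠] 0) (𝓝 1) := by
      simpa using (Real.hasDerivAt_sin 0).tendsto_slope_zero
    have := hs.mul_const I
    rw [one_mul] at this
    refine this.congr fun t => ?_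
    simp only [Fn]
    rw [integral_const_mul, integral_inner_rotation_sub hV]
    simp only [zero_add, Real.sin_zero, sub_zero, smul_eq_mul, mul_assoc]
    rfl
  change 0 ≤ I
  rw [tendsto_nhds_unique h2 h1, integral_prod _ hDi]
  refine integral_nonneg_of_ae ?_
  filter_upwards [hae] with g hg
  have hA := hg.1.hasFDerivAt
  have hB := hg.2.hasFDerivAt
  have hdom' : ∀ u, ‖fderiv ℝ V g u‖ ≤ c * ‖fderiv ℝ X g u‖ := fun u => by
    refine le_of_tendsto_of_tendsto (tendsto_line_of_hasFDerivAt hA u).norm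
      ((tendsto_line_of_hasFDerivAt hB u).norm.const_mul (c : ℝ)) (Eventually.of_forall fun t => ?_)
    simp only [norm_smul]
    rw [mul_left_comm]
    exact mul_le_mul_of_nonneg_left (hdom _ _) (norm_nonneg _)
  -- At a point where both maps are differentiable, the hypotheses on increments pass to the
  -- derivatives: monotonicity gives the two signs, and `hdom` the inclusion of kernels.
  refine integral_inner_clm_nonneg (A := fderiv ℝ V g) (B := fderiv ℝ X g) (fun u w => inner_deriv_symm_of_potential hθ hB u w)
    (fun u => ?_) (fun u => ?_) (fun u hu => ?_)
  · refine ge_of_tendsto ((tendsto_const_nhds (x := u)).inner (𝕜 := ℝ) (tendsto_line_of_hasFDerivAt hB u)) ?_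
    filter_upwards [self_mem_nhdsWithin] with t ht
    have h := hXmono (g + t • u) g
    rw [add_sub_cancel_left, real_inner_smul_left] at h
    rw [real_inner_smul_right]
    -- `t` may be negative; extracting the square `(t⁻¹) ^ 2` leaves the nonnegative increment `h`.
    have : t⁻¹ * inner ℝ u (X (g + t • u) - X g)
        = (t⁻¹) ^ 2 * (t * inner ℝ u (X (g + t • u) - X g)) := by
      have ht' : t ≠ 0 := ht
      field_simp
    rw [this]
    positivity
  · refine ge_of_tendsto ((tendsto_line_of_hasFDerivAt hB u).inner (𝕜 := ℝ) (tendsto_line_of_hasFDerivAt hA u))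
      (Eventually.of_forall fun t => ?_)
    rw [real_inner_smul_left, real_inner_smul_right, ← mul_assoc]
    exact mul_nonneg (mul_self_nonneg _) (hmono _ _)
  · have := hdom' u
    rw [hu, norm_zero, mul_zero] at this
    exact norm_le_zero_iff.1 this

end Stein

end LDPOpt

namespace LDPOpt

open Filter Topology

/-! ### Quadratic upper and lower bounds on a convex set. -/

section ConvexDescent

variable {d : ℕ} {C : Set (E d)} {f : E d → ℝ}

theorem hasDerivAt_comp_segment (hf : Differentiable ℝ f) (x y : E d) (t : ℝ) :
    HasDerivAt (fun s : ℝ => f (x + s • (y - x)))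
      (inner ℝ (gradient f (x + t • (y - x))) (y - x)) t := by
  have h1 : HasDerivAt (fun s : ℝ => x + s • (y - x)) (y - x) t := by
    simpa using ((hasDerivAt_id t).smul_const (y - x)).const_add x
  have h2 := (hf (x + t • (y - x))).hasGradientAt.hasFDerivAt
  simpa [Function.comp_def] using HasFDerivAt.comp_hasDerivAt t h2 h1

/-- The gradient condition is available on `C` only, so the argument stays on the segment from `x`
to `y`: `f` minus its quadratic model has nonpositive derivative along it. -/
theorem le_of_smoothGradOn {M : ℝ} (hf : Differentiable ℝ f) (hconv : Convex ℝ C)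
    (hM : SmoothGradOn M C f) {x y : E d} (hx : x ∈ C) (hy : y ∈ C) :
    f y ≤ f x + inner ℝ (gradient f x) (y - x) + M / 2 * ‖y - x‖ ^ 2 := by
  let h : ℝ → ℝ := fun s => f (x + s • (y - x)) - s * inner ℝ (gradient f x) (y - x)
    - s ^ 2 * (M / 2 * ‖y - x‖ ^ 2)
  have hd : ∀ t, HasDerivAt h (inner ℝ (gradient f (x + t • (y - x))) (y - x)
      - inner ℝ (gradient f x) (y - x) - 2 * t * (M / 2 * ‖y - x‖ ^ 2)) t := fun t => by
    have := ((hasDerivAt_comp_segment hf x y t).fun_sub ((hasDerivAt_id t).mul_const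
      (inner ℝ (gradient f x) (y - x)))).fun_sub
      ((hasDerivAt_pow 2 t).mul_const (M / 2 * ‖y - x‖ ^ 2))
    simpa [h] using this
  have hanti : AntitoneOn h (Set.Icc 0 1) := by
    refine antitoneOn_of_deriv_nonpos (convex_Icc 0 1)
      (fun t _ => (hd t).continuousAt.continuousWithinAt)
      (fun t _ => (hd t).differentiableAt.differentiableWithinAt) fun t ht => ?_
    rw [interior_Icc] at ht
    rw [(hd t).deriv, ← inner_sub_left]
    have hmem : x + t • (y - x) ∈ C := hconv.add_smul_sub_mem hx hy ⟨ht.1.le, ht.2.le⟩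
    have h1 := hM _ hmem x hx
    rw [add_sub_cancel_left, norm_smul, Real.norm_of_nonneg ht.1.le] at h1
    have h2 := real_inner_le_norm (gradient f (x + t • (y - x)) - gradient f x) (y - x)
    have h3 := mul_le_mul_of_nonneg_right h1 (norm_nonneg (y - x))
    nlinarith
  have := hanti (Set.left_mem_Icc.2 zero_le_one) (Set.right_mem_Icc.2 zero_le_one) zero_le_one
  simp only [h, one_smul, zero_smul, add_zero, add_sub_cancel] at this
  linarith

theorem le_of_strongConvexGradOn {m : ℝ} (hf : Differentiable ℝ f) (hconv : Convex ℝ C)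
    (hm : StrongConvexGradOn m C f) {x y : E d} (hx : x ∈ C) (hy : y ∈ C) :
    f x + inner ℝ (gradient f x) (y - x) + m / 2 * ‖y - x‖ ^ 2 ≤ f y := by
  let h : ℝ → ℝ := fun s => f (x + s • (y - x)) - s * inner ℝ (gradient f x) (y - x)
    - s ^ 2 * (m / 2 * ‖y - x‖ ^ 2)
  have hd : ∀ t, HasDerivAt h (inner ℝ (gradient f (x + t • (y - x))) (y - x)
      - inner ℝ (gradient f x) (y - x) - 2 * t * (m / 2 * ‖y - x‖ ^ 2)) t := fun t => by
    have := ((hasDerivAt_comp_segment hf x y t).fun_sub ((hasDerivAt_id t).mul_const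
      (inner ℝ (gradient f x) (y - x)))).fun_sub
      ((hasDerivAt_pow 2 t).mul_const (m / 2 * ‖y - x‖ ^ 2))
    simpa [h] using this
  have hmon : MonotoneOn h (Set.Icc 0 1) := by
    refine monotoneOn_of_deriv_nonneg (convex_Icc 0 1)
      (fun t _ => (hd t).continuousAt.continuousWithinAt)
      (fun t _ => (hd t).differentiableAt.differentiableWithinAt) fun t ht => ?_
    rw [interior_Icc] at ht
    rw [(hd t).deriv, ← inner_sub_left]
    have hmem : x + t • (y - x) ∈ C := hconv.add_smul_sub_mem hx hy ⟨ht.1.le, ht.2.le⟩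
    have h1 := hm _ hmem x hx
    rw [add_sub_cancel_left, norm_smul, Real.norm_of_nonneg ht.1.le, real_inner_smul_left,
      real_inner_comm] at h1
    have h2 : t * (m * t * ‖y - x‖ ^ 2)
        ≤ t * inner ℝ (gradient f (x + t • (y - x)) - gradient f x) (y - x) := by
      calc _ = m * (t * ‖y - x‖) ^ 2 := by ring
        _ ≤ _ := h1
    have h3 := le_of_mul_le_mul_left h2 ht.1
    linarith
  have := hmon (Set.left_mem_Icc.2 zero_le_one) (Set.right_mem_Icc.2 zero_le_one) zero_le_one
  simp only [h, one_smul, zero_smul, add_zero, add_sub_cancel] at this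
  linarith

end ConvexDescent

/-! ### Generalized linear losses and the dimension-free correlation bound. -/

section LinearLoss

variable {d : ℕ} {C : Set (E d)} {φ : ℝ → ℝ → ℝ} {P : LocalData d} {m M L C₂ : ℝ}

theorem hasGradientAt_glf (hφ : ∀ l, Differentiable ℝ fun s => φ s l) (P : LocalData d)
    (x : E d) : HasGradientAt (glf φ P)
      ((1 / (P.b : ℝ)) • ∑ j, deriv (fun s => φ s (P.l j)) (inner ℝ (P.z j) x) • P.z j) x := by
  rw [hasGradientAt_iff_hasFDerivAt]
  have h : ∀ j, HasFDerivAt (fun x : E d => φ (inner ℝ (P.z j) x) (P.l j))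
      (deriv (fun s => φ s (P.l j)) (inner ℝ (P.z j) x) • innerSL ℝ (P.z j)) x := fun j =>
    (hφ (P.l j) (inner ℝ (P.z j) x)).hasDerivAt.comp_hasFDerivAt x (innerSL ℝ (P.z j)).hasFDerivAt
  have h2 := (HasFDerivAt.fun_sum (u := Finset.univ) fun j _ => h j).const_mul (1 / (P.b : ℝ))
  refine h2.congr_fderiv ?_
  ext v
  simp

theorem differentiable_glf (hφ : ∀ l, Differentiable ℝ fun s => φ s l) (P : LocalData d) :
    Differentiable ℝ (glf φ P) := fun x => (hasGradientAt_glf hφ P x).differentiableAt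

theorem inner_gradient_glf (hφ : ∀ l, Differentiable ℝ fun s => φ s l) (P : LocalData d)
    (x v : E d) : inner ℝ v (gradient (glf φ P) x)
      = (1 / (P.b : ℝ)) * ∑ j, deriv (fun s => φ s (P.l j)) (inner ℝ (P.z j) x)
          * inner ℝ (P.z j) v := by
  rw [(hasGradientAt_glf hφ P x).gradient, real_inner_smul_right, inner_sum]
  simp_rw [real_inner_smul_right, real_inner_comm v]

theorem average_le {b : ℕ} (hb : 0 < b) {a : Fin b → ℝ} {c : ℝ} (h : ∀ j, a j ≤ c) :
    (1 / (b : ℝ)) * ∑ j, a j ≤ c := by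
  have hb' : (0 : ℝ) < b := by exact_mod_cast hb
  rw [one_div, inv_mul_le_iff₀ hb']
  calc ∑ j, a j ≤ ∑ _j : Fin b, c := Finset.sum_le_sum fun j _ => h j
    _ = b * c := by simp

/-- Up to a constant, the derivative of the link function is bounded by its Lipschitz constant. The
constant matters only if the link function is evaluated at one point only. -/
theorem exists_abs_deriv_sub_le (hφ : ∀ l, Differentiable ℝ fun s => φ s l) (hconv : Convex ℝ C)
    (hL : 0 < L) (hP : Admissible φ C m M L C₂ P) (j : Fin P.b) :
    ∃ κ, ∀ x ∈ C, |deriv (fun s => φ s (P.l j)) (inner ℝ (P.z j) x) - κ| ≤ L := by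
  by_cases h : ∃ x₁ ∈ C, ∃ x₂ ∈ C, inner ℝ (P.z j) x₁ ≠ inner ℝ (P.z j) x₂
  · obtain ⟨x₁, h₁, x₂, h₂, hne⟩ := h
    refine ⟨0, fun x hx => ?_⟩
    rw [sub_zero]
    -- Some direction from `x` into `C` changes `⟪z_j, ·⟫`. Slopes in that direction are taken for
    -- `t > 0` only, since `x` may lie on the boundary of `C`.
    obtain ⟨w, hw, hwx⟩ : ∃ w ∈ C, inner ℝ (P.z j) (w - x) ≠ (0 : ℝ) := by
      by_contra! hcon
      refine hne ?_
      have e1 := hcon x₁ h₁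
      have e2 := hcon x₂ h₂
      rw [inner_sub_right] at e1 e2
      linarith
    set v : ℝ := inner ℝ (P.z j) (w - x)
    set a : ℝ := inner ℝ (P.z j) x
    have hd : HasDerivAt (fun t : ℝ => φ (a + t * v) (P.l j))
        (deriv (fun s => φ s (P.l j)) a * v) 0 := by
      have h1 : HasDerivAt (fun t : ℝ => a + t * v) v 0 := by
        simpa using ((hasDerivAt_id (0 : ℝ)).mul_const v).const_add a
      have h2 := (hφ (P.l j) (a + 0 * v)).hasDerivAt
      simpa [Function.comp_def] using h2.comp (0 : ℝ) h1
    have hle : |deriv (fun s => φ s (P.l j)) a * v| ≤ L * |v| := by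
      refine le_of_tendsto hd.tendsto_slope_zero_right.abs ?_
      filter_upwards [Ioo_mem_nhdsGT (zero_lt_one' ℝ)] with t ht
      have hmem : x + t • (w - x) ∈ C := hconv.add_smul_sub_mem hx hw ⟨ht.1.le, ht.2.le⟩
      have h1 := hP.lipschitz j _ hmem x hx
      rw [inner_add_right, real_inner_smul_right, add_sub_cancel_left, abs_mul,
        abs_of_pos ht.1] at h1
      simp only [zero_add, zero_mul, add_zero, smul_eq_mul, abs_mul, abs_inv, abs_of_pos ht.1]
      rw [inv_mul_le_iff₀ ht.1]
      calc _ ≤ L * (t * |v|) := h1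
        _ = _ := by ring
    rw [abs_mul] at hle
    exact le_of_mul_le_mul_right hle (abs_pos.2 hwx)
  -- If `⟪z_j, ·⟫` is constant on `C`, the Lipschitz condition is void and the derivative may exceed
  -- `L`; being the same number on all of `C`, it serves as `κ`.
  · push Not at h
    rcases C.eq_empty_or_nonempty with rfl | ⟨x₀, hx₀⟩
    · exact ⟨0, fun x hx => hx.elim⟩
    · refine ⟨deriv (fun s => φ s (P.l j)) (inner ℝ (P.z j) x₀), fun x hx => ?_⟩
      rw [h x hx x₀ hx₀, sub_self, abs_zero]
      exact hL.le

/-- Test the difference of gradients against `x - y`: strong convexity makes it at least `m ‖x -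
y‖²`, the Lipschitz links at most `2 L C₂ ‖x - y‖`, the constants `κ` cancelling. So `C` is bounded,
which gives integrability and controls the initial error. -/
theorem norm_sub_le_of_admissible (hφ : ∀ l, Differentiable ℝ fun s => φ s l)
    (hconv : Convex ℝ C) (hm : 0 < m) (hL : 0 < L) (hP : Admissible φ C m M L C₂ P)
    {x y : E d} (hx : x ∈ C) (hy : y ∈ C) : ‖x - y‖ ≤ 2 * L * C₂ / m := by
  have h := hP.strongConvex x hx y hy
  rw [inner_sub_right, inner_gradient_glf hφ, inner_gradient_glf hφ, ← mul_sub,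
    ← Finset.sum_sub_distrib] at h
  have h2 := h.trans (average_le P.b_pos (c := 2 * L * (C₂ * ‖x - y‖)) fun j => by
    obtain ⟨κ, hκ⟩ := exists_abs_deriv_sub_le hφ hconv hL hP j
    have h1 := abs_le.1 (hκ x hx)
    have h2 := abs_le.1 (hκ y hy)
    have h3 : |(inner ℝ (P.z j) (x - y) : ℝ)| ≤ C₂ * ‖x - y‖ :=
      (abs_real_inner_le_norm _ _).trans
        (mul_le_mul_of_nonneg_right (hP.norm_le j) (norm_nonneg _))
    rw [← sub_mul]
    refine (le_abs_self _).trans ?_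
    rw [abs_mul]
    refine mul_le_mul ?_ h3 (abs_nonneg _) (by positivity)
    rw [abs_le]
    constructor <;> linarith)
  have hC₂ : 0 ≤ C₂ := (norm_nonneg _).trans (hP.norm_le ⟨0, P.b_pos⟩)
  rcases (norm_nonneg (x - y)).eq_or_lt with h0 | h0
  · rw [← h0]; positivity
  · rw [le_div_iff₀ hm]
    refine le_of_mul_le_mul_right ?_ h0
    nlinarith

theorem lipschitzWith_proj_add_smul (hne : C.Nonempty) (hC : IsClosed C) (hconv : Convex ℝ C) (y : E d)
    {s : ℝ} (hs : 0 < s) :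
    LipschitzWith (Real.toNNReal s) fun g => proj C (y + s • g) := by
  refine LipschitzWith.of_dist_le_mul fun a b => ?_
  rw [dist_eq_norm, dist_eq_norm, Real.coe_toNNReal _ hs.le]
  refine (norm_proj_sub_le hne hC hconv _ _).trans ?_
  rw [add_sub_add_left_eq_sub, ← smul_sub, norm_smul, Real.norm_of_nonneg hs.le]

/-- The correlation of a Gaussian vector with the projection of a translate of it onto `C` is
bounded independently of the dimension, because `C` carries a strongly convex generalized linear
loss. -/
theorem integral_inner_proj_le (hφ : ∀ l, Differentiable ℝ fun s => φ s l) (hne : C.Nonempty)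
    (hC : IsClosed C) (hconv : Convex ℝ C) (hm : 0 < m) (hM : 0 < M) (hL : 0 < L)
    (hP : Admissible φ C m M L C₂ P) (y : E d) {s : ℝ} (hs : 0 < s) :
    ∫ g, inner ℝ g (proj C (y + s • g)) ∂(stdGaussian (E d)) ≤ L * C₂ / m := by
  let X : E d → E d := fun g => proj C (y + s • g)
  let G : E d → E d := fun g => gradient (glf φ P) (X g)
  -- Strong convexity says exactly that `∇f - m • id` is monotone on `C`, so `V` is a monotone
  -- function of `X`, and `0 ≤ E⟪g, V g⟫` bounds `m E⟪g, X g⟫` by `E⟪g, G g⟫`.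
  let V : E d → E d := fun g => G g - m • X g
  have hXC : ∀ g, X g ∈ C := fun g => (proj_spec hne hC _).1
  have hX : LipschitzWith (Real.toNNReal s) X := lipschitzWith_proj_add_smul hne hC hconv y hs
  have hGd : ∀ a b, ‖G a - G b‖ ≤ M * ‖X a - X b‖ := fun a b =>
    hP.smooth _ (hXC a) _ (hXC b)
  have hG : LipschitzWith (Real.toNNReal M * Real.toNNReal s) G :=
    LipschitzWith.of_dist_le_mul fun a b => by
      have h := hX.dist_le_mul a b
      rw [dist_eq_norm] at h ⊢
      push_cast
      rw [Real.coe_toNNReal _ hM.le, mul_assoc]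
      exact (hGd a b).trans (by gcongr)
  have hVd : ∀ a b, ‖V a - V b‖ ≤ (Real.toNNReal (M + m) : ℝ) * ‖X a - X b‖ := fun a b => by
    rw [Real.coe_toNNReal _ (by positivity)]
    have e : V a - V b = (G a - G b) - m • (X a - X b) := by
      simp only [V, smul_sub]; abel
    rw [e]
    refine (norm_sub_le _ _).trans ?_
    rw [norm_smul, Real.norm_of_nonneg hm.le]
    linarith [hGd a b]
  have hV : LipschitzWith (Real.toNNReal (M + m) * Real.toNNReal s) V :=
    LipschitzWith.of_dist_le_mul fun a b => by
      have h := hX.dist_le_mul a b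
      rw [dist_eq_norm] at h ⊢
      push_cast
      rw [mul_assoc]
      exact (hVd a b).trans (by gcongr)
  have key : 0 ≤ ∫ g, inner ℝ g (V g) ∂(stdGaussian (E d)) := by
    refine integral_inner_nonneg_of_monotone (θ := fun g => s⁻¹ * projPotential C (y + s • g))
      hV hX (fun v => ?_) (fun a b => ?_) (fun a b => ?_) hVd
    · have h1 : HasFDerivAt (fun g : E d => y + s • g) (s • ContinuousLinearMap.id ℝ (E d)) v :=
        ((hasFDerivAt_id v).const_smul s).const_add y
      have h2 := ((hasFDerivAt_projPotential hne hC hconv (y + s • v)).comp v h1).const_mul s⁻¹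
      refine h2.congr_fderiv ?_
      ext w
      simp [X, innerSL_apply_apply ℝ, hs.ne']
    · have h := norm_proj_sub_sq_le hne hC hconv (y + s • a) (y + s • b)
      rw [add_sub_add_left_eq_sub, ← smul_sub, real_inner_smul_left] at h
      exact nonneg_of_mul_nonneg_right ((sq_nonneg _).trans h) hs
    · have h := hP.strongConvex _ (hXC a) _ (hXC b)
      have e : V a - V b = (G a - G b) - m • (X a - X b) := by
        simp only [V, smul_sub]; abel
      rw [e, inner_sub_right, real_inner_smul_right, real_inner_self_eq_norm_sq]
      exact sub_nonneg.2 h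
  have hsplit : ∫ g, inner ℝ g (V g) ∂(stdGaussian (E d))
      = ∫ g, inner ℝ g (G g) ∂(stdGaussian (E d))
        - m * ∫ g, inner ℝ g (X g) ∂(stdGaussian (E d)) := by
    simp only [V, inner_sub_right, real_inner_smul_right]
    rw [integral_sub (integrable_inner_of_lipschitz hG)
      ((integrable_inner_of_lipschitz hX).const_mul m), integral_const_mul]
  -- The constants `κ j` multiply centered variables and drop out of the mean; what remains of each
  -- link derivative is at most `L`.
  have hbound : ∫ g, inner ℝ g (G g) ∂(stdGaussian (E d)) ≤ L * C₂ := by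
    choose κ hκ using exists_abs_deriv_sub_le hφ hconv hL hP
    have hz : ∀ z : E d, Integrable (fun g => inner ℝ z g) (stdGaussian (E d)) := fun z =>
      (innerSL ℝ z).integrable_comp IsGaussian.integrable_id
    have hzero : ∀ z : E d, ∫ g, inner ℝ z g ∂(stdGaussian (E d)) = 0 := fun z => by
      simpa [real_inner_comm] using integral_inner_stdGaussian_eq_zero z
    let B : E d → ℝ := fun g => (1 / (P.b : ℝ)) * ∑ j, (L * |inner ℝ (P.z j) g|
      + κ j * inner ℝ (P.z j) g)
    have hBi : ∀ j, Integrable (fun g : E d => L * |inner ℝ (P.z j) g|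
        + κ j * inner ℝ (P.z j) g) (stdGaussian (E d)) := fun j =>
      ((hz _).abs.const_mul L).add ((hz _).const_mul _)
    calc ∫ g, inner ℝ g (G g) ∂(stdGaussian (E d)) ≤ ∫ g, B g ∂(stdGaussian (E d)) := by
          refine integral_mono (integrable_inner_of_lipschitz hG)
            ((integrable_finsetSum _ fun j _ => hBi j).const_mul _) fun g => ?_
          simp only [G, B]
          rw [inner_gradient_glf hφ]
          refine mul_le_mul_of_nonneg_left (Finset.sum_le_sum fun j _ => ?_) (by positivity)
          have h := le_abs_self ((deriv (fun s => φ s (P.l j)) (inner ℝ (P.z j) (X g)) - κ j)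
            * inner ℝ (P.z j) g)
          rw [abs_mul] at h
          have h2 := mul_le_mul_of_nonneg_right (hκ j (X g) (hXC g))
            (abs_nonneg (inner ℝ (P.z j) g : ℝ))
          linarith
      _ ≤ L * C₂ := by
          simp only [B]
          rw [integral_const_mul, integral_finsetSum _ fun j _ => hBi j]
          refine average_le P.b_pos fun j => ?_
          rw [integral_add ((hz _).abs.const_mul L) ((hz _).const_mul _), integral_const_mul,
            integral_const_mul, hzero, mul_zero, add_zero]
          exact mul_le_mul_of_nonneg_left
            ((integral_abs_inner_stdGaussian_le _).trans (hP.norm_le j)) hL.le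
  rw [le_div_iff₀ hm]
  rw [hsplit] at key
  linarith

end LinearLoss

/-! ### The correlation bound at noise level `σ`. -/

section Noise

variable {d : ℕ}

instance isProbabilityMeasure_gaussianNoise (σ : ℝ) :
    IsProbabilityMeasure (gaussianNoise d σ) :=
  Measure.isProbabilityMeasure_map (by fun_prop)

instance isProbabilityMeasure_noiseLaw (K N : ℕ) (σ : ℝ) :
    IsProbabilityMeasure (noiseLaw K N d σ) := by
  unfold noiseLaw; infer_instance

theorem integrable_norm_gaussianNoise (σ : ℝ) :
    Integrable (fun g : E d => ‖g‖) (gaussianNoise d σ) := by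
  rw [gaussianNoise, integrable_map_measure (by fun_prop) (by fun_prop)]
  simpa [Function.comp_def, norm_smul] using integrable_norm_stdGaussian.const_mul |σ|

theorem integral_gaussianNoise (σ : ℝ) {F : E d → ℝ} (hF : Continuous F) :
    ∫ x, F x ∂(gaussianNoise d σ) = ∫ g, F (σ • g) ∂(stdGaussian (E d)) := by
  rw [gaussianNoise, integral_map (by fun_prop) hF.aestronglyMeasurable]

/-- The bound does not involve the scale `s`, which will be `1/N` from averaging over the agents;
the fixed `u` contributes zero mean. -/
theorem integral_inner_proj_gaussianNoise_le {C : Set (E d)} {φ : ℝ → ℝ → ℝ} {P : LocalData d}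
    {m M L C₂ : ℝ} (hφ : ∀ l, Differentiable ℝ fun s => φ s l) (hne : C.Nonempty)
    (hC : IsClosed C) (hconv : Convex ℝ C) (hm : 0 < m) (hM : 0 < M) (hL : 0 < L)
    (hP : Admissible φ C m M L C₂ P) (y u : E d) {s σ : ℝ} (hs : 0 < s) (hσ : 0 < σ) :
    ∫ x, inner ℝ x (proj C (y + s • x) - u) ∂(gaussianNoise d σ) ≤ σ * (L * C₂ / m) := by
  have hc := continuous_proj hne hC hconv
  rw [integral_gaussianNoise σ (by fun_prop)]
  have hX := lipschitzWith_proj_add_smul hne hC hconv y (mul_pos hs hσ)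
  have e : ∀ g : E d, inner ℝ (σ • g) (proj C (y + s • σ • g) - u)
      = σ * (inner ℝ g (proj C (y + (s * σ) • g)) - inner ℝ g u) := fun g => by
    rw [real_inner_smul_left, smul_smul, inner_sub_right]
  simp_rw [e]
  have hu : Integrable (fun g : E d => inner ℝ g u) (stdGaussian (E d)) := by
    simpa [real_inner_comm] using (innerSL ℝ u).integrable_comp
      (IsGaussian.integrable_id (μ := stdGaussian (E d)))
  rw [integral_const_mul, integral_sub (integrable_inner_of_lipschitz hX) hu,
    integral_inner_stdGaussian_eq_zero, sub_zero]
  exact mul_le_mul_of_nonneg_left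
    (integral_inner_proj_le hφ hne hC hconv hm hM hL hP y (mul_pos hs hσ)) hσ.le

end Noise

end LDPOpt

namespace LDPOpt

open scoped ENNReal

/-! ### Rényi-type bounds and their adaptive composition. -/

section LebesgueBound

variable {α β : Type*} [MeasurableSpace α] [MeasurableSpace β]

/-- The law of `T` under `μ` integrates a function at most as `c` times its `L^q(μ)` norm. This is a
bound of the Rényi divergence between the two laws which is stable under adaptive composition. -/
def LebesgueBound (q : ℝ) (μ : Measure α) (T : α → α) (c : ℝ≥0∞) : Prop :=
  ∀ h : α → ℝ≥0∞, Measurable h → ∫⁻ x, h (T x) ∂μ ≤ c * (∫⁻ x, h x ^ q ∂μ) ^ (1 / q)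

theorem LebesgueBound.mono {q : ℝ} {μ : Measure α} {T : α → α} {c c' : ℝ≥0∞}
    (h : LebesgueBound q μ T c) (hc : c ≤ c') : LebesgueBound q μ T c' := fun f hf =>
  (h f hf).trans (by gcongr)

theorem LebesgueBound.map {q : ℝ} {μ : Measure α} {T : α → α} {c : ℝ≥0∞}
    (h : LebesgueBound q μ T c) {e : α → β} (he : Measurable e) {T' : β → β} (hT' : Measurable T')
    (hconj : ∀ x, T' (e x) = e (T x)) : LebesgueBound q (μ.map e) T' c := fun f hf => by
  have hfT : Measurable fun y => f (T' y) := hf.comp hT'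
  rw [lintegral_map hfT he, lintegral_map (hf.pow_const q) he]
  simp_rw [hconj]
  exact h _ (hf.comp he)

theorem LebesgueBound.measure_preimage_le {q : ℝ} (hq : 0 < q) {μ : Measure α} {T : α → α}
    {c : ℝ≥0∞} (h : LebesgueBound q μ T c) (hT : Measurable T) {A : Set α}
    (hA : MeasurableSet A) : μ (T ⁻¹' A) ≤ c * μ A ^ (1 / q) := by
  have h1 := h (A.indicator 1) (measurable_one.indicator hA)
  have e1 : ∫⁻ x, A.indicator (1 : α → ℝ≥0∞) (T x) ∂μ = μ (T ⁻¹' A) := by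
    rw [← lintegral_indicator_one (hT hA)]
    rfl
  have e2 : ∫⁻ x, A.indicator (1 : α → ℝ≥0∞) x ^ q ∂μ = μ A := by
    rw [← lintegral_indicator_one hA]
    refine lintegral_congr fun x => ?_
    by_cases hx : x ∈ A <;> simp [hx, hq]
  rwa [e1, e2] at h1

/-- Adaptive composition: `Ψ` is causal, and each coordinate obeys its bound with the others frozen.
Peel off coordinate `0`, apply the induction hypothesis on each fibre, then the bound of coordinate
`0` to the fibrewise `L^q` norm `H`, whose own `L^q` norm is that of `f`. -/
theorem LebesgueBound.pi {q : ℝ} (hq : 0 < q) {μ : Measure α} [IsProbabilityMeasure μ] :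
    ∀ {n : ℕ} {Ψ : (Fin n → α) → Fin n → α} {c : Fin n → ℝ≥0∞}, Measurable Ψ →
      (∀ x y k, (∀ j ≤ k, x j = y j) → Ψ x k = Ψ y k) →
      (∀ k x, LebesgueBound q μ (fun a => Ψ (Function.update x k a) k) (c k)) →
      LebesgueBound q (Measure.pi fun _ => μ) Ψ (∏ k, c k) := by
  intro n
  induction n with
  | zero =>
    intro Ψ c _ _ _ f _
    rw [Measure.pi_of_empty, lintegral_dirac, lintegral_dirac, ← ENNReal.rpow_mul,
      mul_one_div_cancel hq.ne', ENNReal.rpow_one]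
    refine le_of_eq ?_
    rw [Finset.prod_of_isEmpty, one_mul]
    exact congrArg f (Subsingleton.elim _ _)
  | succ n ih =>
    intro Ψ c hΨ hcausal hbound f hf
    have : Nonempty α := μ.nonempty_of_neZero
    obtain ⟨x₀⟩ : Nonempty (Fin (n + 1) → α) := inferInstance
    have hmp := (measurePreserving_piFinSuccAbove (fun _ : Fin (n + 1) => μ) 0).symm
    have hcons : ∀ p : α × (Fin n → α),
        (MeasurableEquiv.piFinSuccAbove (fun _ : Fin (n + 1) => α) 0).symm p
          = Fin.cons p.1 p.2 := fun p => Fin.insertNth_zero' p.1 p.2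
    have hmc : Measurable fun p : α × (Fin n → α) => (Fin.cons p.1 p.2 : Fin (n + 1) → α) := by
      simp_rw [← hcons]
      exact MeasurableEquiv.measurable _
    have hfub : ∀ g : (Fin (n + 1) → α) → ℝ≥0∞, Measurable g →
        ∫⁻ x, g x ∂(Measure.pi fun _ => μ)
          = ∫⁻ a, ∫⁻ y, g (Fin.cons a y) ∂(Measure.pi fun _ => μ) ∂μ := fun g hg => by
      rw [← hmp.lintegral_comp hg]
      simp_rw [hcons]
      exact lintegral_prod _ (hg.comp hmc).aemeasurable
    let T : α → α := fun a => Ψ (Function.update x₀ 0 a) 0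
    let Ψ' : α → (Fin n → α) → Fin n → α := fun a y k => Ψ (Fin.cons a y) k.succ
    have hsplit : ∀ a y, Ψ (Fin.cons a y) = Fin.cons (T a) (Ψ' a y) := fun a y => by
      funext k
      refine Fin.cases ?_ (fun k => ?_) k
      · refine hcausal _ _ _ fun j hj => ?_
        rw [Fin.le_zero_iff.1 hj]
        simp
      · simp [Ψ']
    have hΨ'm : ∀ a, Measurable (Ψ' a) := fun a => measurable_pi_lambda _ fun k =>
      (measurable_pi_apply k.succ).comp (hΨ.comp (hmc.comp measurable_prodMk_left))
    have hΨ' : ∀ a, LebesgueBound q (Measure.pi fun _ => μ) (Ψ' a) (∏ k : Fin n, c k.succ) :=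
      fun a => by
        refine ih (hΨ'm a) (fun x y k hxy => ?_) fun k y => ?_
        · refine hcausal _ _ _ fun j => ?_
          refine Fin.cases (fun _ => by simp) (fun j hj => ?_) j
          simpa using hxy j (Fin.succ_le_succ_iff.1 hj)
        · simpa only [Ψ', Fin.cons_update] using hbound k.succ (Fin.cons a y)
    have hHm : Measurable fun b => ∫⁻ y, f (Fin.cons b y) ^ q ∂(Measure.pi fun _ => μ) :=
      Measurable.lintegral_prod_right' (f := fun p : α × (Fin n → α) => f (Fin.cons p.1 p.2) ^ q)
        ((hf.comp hmc).pow_const q)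
    let H : α → ℝ≥0∞ := fun b => (∫⁻ y, f (Fin.cons b y) ^ q ∂(Measure.pi fun _ => μ)) ^ (1 / q)
    have hH : Measurable H := hHm.pow_const _
    have hHq : ∀ b, H b ^ q = ∫⁻ y, f (Fin.cons b y) ^ q ∂(Measure.pi fun _ => μ) := fun b => by
      simp only [H]
      rw [← ENNReal.rpow_mul, one_div_mul_cancel hq.ne', ENNReal.rpow_one]
    calc ∫⁻ x, f (Ψ x) ∂(Measure.pi fun _ => μ)
        = ∫⁻ a, ∫⁻ y, f (Fin.cons (T a) (Ψ' a y)) ∂(Measure.pi fun _ => μ) ∂μ := by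
          have hfΨ : Measurable fun x => f (Ψ x) := hf.comp hΨ
          rw [hfub _ hfΨ]
          simp_rw [hsplit]
      _ ≤ ∫⁻ a, (∏ k : Fin n, c k.succ) * H (T a) ∂μ :=
          lintegral_mono fun a => hΨ' a _ (hf.comp (hmc.comp measurable_prodMk_left))
      _ ≤ c 0 * (∫⁻ a, ((∏ k : Fin n, c k.succ) * H a) ^ q ∂μ) ^ (1 / q) :=
          hbound 0 x₀ _ (hH.const_mul _)
      _ = (∏ k, c k) * (∫⁻ x, f x ^ q ∂(Measure.pi fun _ => μ)) ^ (1 / q) := by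
          simp_rw [ENNReal.mul_rpow_of_nonneg _ _ hq.le, hHq]
          rw [lintegral_const_mul _ hHm, ENNReal.mul_rpow_of_nonneg _ _ (by positivity), ← ENNReal.rpow_mul,
            mul_one_div_cancel hq.ne', ENNReal.rpow_one, hfub _ (hf.pow_const q), ← mul_assoc,
            ← Fin.prod_univ_succ]

end LebesgueBound

/-! ### Shifts of Gaussian measures. -/

section GaussianShift

/-- Hölder's inequality against the likelihood ratio `exp(b x - b²/2)`, whose `L^a` norm is the
stated constant. -/
theorem lebesgueBound_gaussianReal {a q : ℝ} (hq : a.HolderConjugate q) (b : ℝ) :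
    LebesgueBound q (gaussianReal 0 1) (fun x => x + b)
      (ENNReal.ofReal (Real.exp ((a - 1) * b ^ 2 / 2))) := fun h hh => by
  have ha := hq.pos
  let D : ℝ → ℝ≥0∞ := fun x => ENNReal.ofReal (Real.exp (b * x - b ^ 2 / 2))
  have hD : Measurable D := by fun_prop
  have hpdf : ∀ x, gaussianPDF b 1 x = gaussianPDF 0 1 x * D x := fun x => by
    simp only [gaussianPDF, D]
    rw [← ENNReal.ofReal_mul (gaussianPDFReal_nonneg _ _ _)]
    congr 1
    simp only [gaussianPDFReal]
    rw [mul_assoc (√(2 * Real.pi * _))⁻¹, ← Real.exp_add]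
    congr 2
    simp
    ring
  have h1 : ∫⁻ x, h (x + b) ∂(gaussianReal 0 1) = ∫⁻ x, (D * h) x ∂(gaussianReal 0 1) := by
    rw [← lintegral_map hh (by fun_prop : Measurable fun x : ℝ => x + b),
      gaussianReal_map_add_const, zero_add, gaussianReal_of_var_ne_zero _ one_ne_zero,
      gaussianReal_of_var_ne_zero _ one_ne_zero,
      lintegral_withDensity_eq_lintegral_mul _ (measurable_gaussianPDF _ _) hh,
      lintegral_withDensity_eq_lintegral_mul _ (measurable_gaussianPDF _ _) (hD.mul hh)]
    refine lintegral_congr fun x => ?_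
    simp only [Pi.mul_apply, hpdf, mul_assoc]
  have h2 : (∫⁻ x, D x ^ a ∂(gaussianReal 0 1)) ^ (1 / a)
      = ENNReal.ofReal (Real.exp ((a - 1) * b ^ 2 / 2)) := by
    have e : ∀ x, D x ^ a = ENNReal.ofReal (Real.exp (-(a * b ^ 2 / 2)) * Real.exp (a * b * x)) :=
      fun x => by
        simp only [D]
        rw [ENNReal.ofReal_rpow_of_pos (Real.exp_pos _), ← Real.exp_mul, ← Real.exp_add]
        congr 2
        ring
    have hmgf : ∫ x, Real.exp (a * b * x) ∂(gaussianReal 0 1) = Real.exp ((a * b) ^ 2 / 2) := by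
      have := mgf_gaussianReal (p := gaussianReal 0 1) (X := id) (μ := 0) (v := 1) (by simp) (a * b)
      simpa [mgf] using this
    simp_rw [e]
    rw [← ofReal_integral_eq_lintegral_ofReal
      ((integrable_exp_mul_gaussianReal (a * b)).const_mul _)
      (Filter.Eventually.of_forall fun x => by positivity), integral_const_mul, hmgf,
      ← Real.exp_add, ENNReal.ofReal_rpow_of_pos (Real.exp_pos _), ← Real.exp_mul]
    congr 2
    field_simp
    ring
  rw [h1, ← h2]
  exact ENNReal.lintegral_mul_le_Lp_mul_Lq _ hq hD.aemeasurable hh.aemeasurable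

theorem lebesgueBound_gaussianNoise {d : ℕ} {a q σ : ℝ} (hq : a.HolderConjugate q) (hσ : 0 < σ)
    (w : E d) : LebesgueBound q (gaussianNoise d σ) (fun x => x + w)
      (ENNReal.ofReal (Real.exp ((a - 1) * ‖w‖ ^ 2 / (2 * σ ^ 2)))) := by
  have h := LebesgueBound.pi hq.symm.pos (μ := gaussianReal 0 1) (n := d)
    (Ψ := fun x t => x t + w t / σ)
    (c := fun t => ENNReal.ofReal (Real.exp ((a - 1) * (w t / σ) ^ 2 / 2)))
    (by fun_prop) (fun x y k hxy => by rw [hxy k le_rfl])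
    (fun k x => by simpa using lebesgueBound_gaussianReal hq (w k / σ))
  rw [gaussianNoise, ← map_pi_eq_stdGaussian, Measure.map_map (by fun_prop) (by fun_prop)]
  refine (h.map (e := (fun g : E d => σ • g) ∘ WithLp.toLp 2) (by fun_prop) (by fun_prop)
    fun x => ?_).mono (le_of_eq ?_)
  · ext t
    simp only [Function.comp_apply, PiLp.add_apply, PiLp.smul_apply, smul_eq_mul]
    field_simp
  · rw [← ENNReal.ofReal_prod_of_nonneg fun _ _ => (Real.exp_pos _).le, ← Real.exp_sum,
      EuclideanSpace.real_norm_sq_eq]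
    congr 2
    rw [Finset.mul_sum, Finset.sum_div]
    refine Finset.sum_congr rfl fun t _ => ?_
    field_simp

theorem lebesgueBound_pi_gaussianNoise {N d : ℕ} {a q σ B : ℝ} (hq : a.HolderConjugate q)
    (hσ : 0 < σ) (i : Fin N) {w : Fin N → E d} (hw : ∀ j, j ≠ i → w j = 0) (hB : ‖w i‖ ≤ B) :
    LebesgueBound q (Measure.pi fun _ : Fin N => gaussianNoise d σ) (fun x => x + w)
      (ENNReal.ofReal (Real.exp ((a - 1) * B ^ 2 / (2 * σ ^ 2)))) := by
  have h := LebesgueBound.pi hq.symm.pos (μ := gaussianNoise d σ) (n := N)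
    (Ψ := fun x j => x j + w j)
    (c := fun j => ENNReal.ofReal (Real.exp ((a - 1) * ‖w j‖ ^ 2 / (2 * σ ^ 2))))
    (by fun_prop) (fun x y k hxy => by rw [hxy k le_rfl])
    (fun k x => by simpa using lebesgueBound_gaussianNoise hq hσ (w k))
  refine LebesgueBound.mono h ?_
  rw [Finset.prod_eq_single i (fun j _ hj => by simp [hw j hj]) (by simp)]
  have := hq.lt
  gcongr

end GaussianShift

/-- Conversion of a bound from Hölder's inequality to `(ε, δ)`-indistinguishability. -/
theorem le_exp_mul_add_of_le_rpow {p r a ε δ k : ℝ} (hr : 0 ≤ r) (ha : 1 < a)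
    (hδ : 0 < δ) (h : p ≤ Real.exp k * r ^ (1 - 1 / a))
    (hε : k * a + Real.log (1 / δ) ≤ ε * (a - 1)) : p ≤ Real.exp ε * r + δ := by
  rcases le_or_gt p δ with hp | hp
  · nlinarith [mul_nonneg (Real.exp_pos ε).le hr]
  have hp0 : 0 < p := hδ.trans hp
  have ha0 : 0 < a := one_pos.trans ha
  rcases hr.eq_or_lt with rfl | hr0
  · rw [Real.zero_rpow (sub_pos.2 ((div_lt_one ha0).2 ha)).ne'] at h
    linarith
  have hlog : Real.log p ≤ k + (1 - 1 / a) * Real.log r := by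
    have := Real.log_le_log hp0 h
    rwa [Real.log_mul (Real.exp_pos _).ne' (Real.rpow_pos_of_pos hr0 _).ne', Real.log_exp,
      Real.log_rpow hr0] at this
  have hδp : Real.log δ ≤ Real.log p := Real.log_le_log hδ hp.le
  rw [one_div, Real.log_inv] at hε
  have h2 : a * Real.log p ≤ a * k + (a - 1) * Real.log r := by
    calc a * Real.log p ≤ a * (k + (1 - 1 / a) * Real.log r) := by gcongr
      _ = _ := by field_simp
  -- Since `p > δ`, one copy of `log p` in `h2` may be replaced by `log δ`; the other `a - 1` copies
  -- are compared with `(a - 1) (ε + log r)` through `hε`.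
  have h3 : Real.log p ≤ ε + Real.log r := by
    refine le_of_mul_le_mul_left ?_ (sub_pos.2 ha)
    nlinarith
  have h4 : p ≤ Real.exp ε * r := by
    rw [← Real.exp_log hp0, ← Real.exp_log hr0, ← Real.exp_add]
    exact Real.exp_le_exp.2 h3
  linarith

end LDPOpt

namespace LDPOpt

open scoped ENNReal

/-! ### Dependence of the iterates on the noise. -/

section Iterates

variable {N d K : ℕ} {C : Set (E d)} {η : ℕ → ℝ} {x₀ : Fin N → E d}

theorem continuous_average : Continuous (average : (Fin N → E d) → E d) := by
  unfold average; fun_prop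

theorem iterates_congr (f : Fin N → E d → ℝ) {Δ Δ' : ℕ → Fin N → E d} :
    ∀ {k : ℕ}, (∀ j < k, Δ j = Δ' j) → iterates C η f x₀ Δ k = iterates C η f x₀ Δ' k
  | 0, _ => rfl
  | k + 1, h => by
    have ih := iterates_congr f (k := k) fun j hj => h j (hj.trans k.lt_succ_self)
    funext i
    simp only [iterates, ih, h k k.lt_succ_self]

theorem continuous_extend (k : ℕ) :
    Continuous fun Δ : Fin K → Fin N → E d => extend Δ k := by
  unfold extend
  split_ifs <;> fun_prop

theorem continuous_iterates {f : Fin N → E d → ℝ} (hproj : Continuous (proj C))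
    (hgrad : ∀ i, Continuous fun y => gradient (f i) (proj C y)) (k : ℕ) :
    Continuous fun Δ : Fin K → Fin N → E d => iterates C η f x₀ (extend Δ) k := by
  induction k with
  | zero => exact continuous_const
  | succ k ih =>
    refine continuous_pi fun i => ?_
    have h1 : Continuous fun Δ : Fin K → Fin N → E d =>
      average (iterates C η f x₀ (extend Δ) k) := continuous_average.comp ih
    have h2 : Continuous fun Δ : Fin K → Fin N → E d => extend Δ k i :=
      (continuous_apply i).comp (continuous_extend k)
    have h3 : Continuous fun Δ : Fin K → Fin N → E d =>
      proj C (average (iterates C η f x₀ (extend Δ) k)) := hproj.comp h1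
    have h4 : Continuous fun Δ : Fin K → Fin N → E d =>
      gradient (f i) (proj C (average (iterates C η f x₀ (extend Δ) k))) := (hgrad i).comp h1
    simp only [iterates, center]
    exact (h3.sub (h4.const_smul (η (k + 1)))).add h2

/-- A change of data is absorbed by a causal shift of the noise that leaves the transcript
unchanged, so privacy only compares the noise law with its shifted image. -/
theorem iterates_shift {f f' : Fin N → E d → ℝ} {Δ Δ' : ℕ → Fin N → E d}
    {n : ℕ} (h : ∀ k < n, ∀ i, Δ' k i = Δ k i + η (k + 1) •
      (gradient (f' i) (center C (iterates C η f x₀ Δ k))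
        - gradient (f i) (center C (iterates C η f x₀ Δ k)))) :
    ∀ k ≤ n, iterates C η f' x₀ Δ' k = iterates C η f x₀ Δ k
  | 0, _ => rfl
  | k + 1, hk => by
    have ih := iterates_shift h k (Nat.le_of_succ_le hk)
    funext i
    simp only [iterates, ih, h k hk i, smul_sub]
    abel

end Iterates

/-! ### Local differential privacy of the transcript. -/

section Privacy

variable {N d K : ℕ} {C : Set (E d)} {φ : ℝ → ℝ → ℝ} {x₀ : Fin N → E d} {m M L C₂ B₂ : ℝ}

theorem continuous_gradient_proj {P : LocalData d} (hne : C.Nonempty) (hC : IsClosed C)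
    (hconv : Convex ℝ C) (hM : 0 < M) (hP : Admissible φ C m M L C₂ P) :
    Continuous fun y => gradient (glf φ P) (proj C y) :=
  (LipschitzWith.of_dist_le_mul (K := M.toNNReal) fun a b => by
    rw [dist_eq_norm, dist_eq_norm, Real.coe_toNNReal _ hM.le]
    refine (hP.smooth _ (proj_spec hne hC a).1 _ (proj_spec hne hC b).1).trans ?_
    have := norm_proj_sub_le hne hC hconv a b
    gcongr).continuous

/-- The Gaussian mechanism: `K` adaptive rounds in which the message of one agent is shifted by at
most `η B₂` are `(ε, δ)`-private for `σ² = K (η B₂)² (1 + 3 log (1/δ)) / ε²`. -/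
theorem isLDP_transcript {𝓕 : Fin N → Set (LocalData d)} {ε δ σ : ℝ} (hne : C.Nonempty)
    (hC : IsClosed C) (hconv : Convex ℝ C) (hM : 0 < M)
    (hδ : 0 < δ) (hδ1 : δ < 1) (hε : 0 < ε) (hεδ : ε ≤ 1 + Real.log (1 / δ)) (hσ : 0 < σ)
    (hσ2 : σ ^ 2 = K * (B₂ / M) ^ 2 * (1 + 3 * Real.log (1 / δ)) / ε ^ 2)
    (hadm : ∀ i, ∀ P ∈ 𝓕 i, Admissible φ C m M L C₂ P)
    (hsens : ∀ i, SensitivityLE φ C B₂ (𝓕 i)) :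
    IsLDP (noiseLaw K N d σ) (fun D => transcript C (fun _ => 1 / M) φ x₀ D) 𝓕 ε δ := by
  intro D D' hD hD' i hDD' S hS
  set ℓ := Real.log (1 / δ)
  have hℓ : 0 < ℓ := Real.log_pos ((one_lt_div hδ).2 hδ1)
  -- This Hölder exponent makes `ε (a - 1) = 2 ℓ`: one `ℓ` pays for `log(1/δ)`, the other for the
  -- `K` rounds of shifts.
  let a : ℝ := 1 + 2 * ℓ / ε
  have ha : 1 < a := by simp only [a]; linarith [show 0 < 2 * ℓ / ε by positivity]
  have hq : a.HolderConjugate (Real.conjExponent a) := Real.HolderConjugate.conjExponent ha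
  set q := Real.conjExponent a
  let p : (Fin K → Fin N → E d) → ℕ → E d := fun Δ k =>
    center C (iterates C (fun _ => 1 / M) (fun j => glf φ (D j)) x₀ (extend Δ) k)
  let v : (Fin K → Fin N → E d) → Fin K → Fin N → E d := fun Δ k j =>
    (1 / M) • (gradient (glf φ (D' j)) (p Δ k) - gradient (glf φ (D j)) (p Δ k))
  let Ψ : (Fin K → Fin N → E d) → Fin K → Fin N → E d := fun Δ => Δ + v Δ
  have hproj := continuous_proj hne hC hconv
  have hg : ∀ j, Continuous fun y => gradient (glf φ (D j)) (proj C y) := fun j =>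
    continuous_gradient_proj hne hC hconv hM (hadm j _ (hD j))
  have hg' : ∀ j, Continuous fun y => gradient (glf φ (D' j)) (proj C y) := fun j =>
    continuous_gradient_proj hne hC hconv hM (hadm j _ (hD' j))
  have hΨm : Measurable Ψ := by
    refine Continuous.measurable (continuous_id.add (continuous_pi fun k => continuous_pi fun j => ?_))
    have h1 : Continuous fun Δ : Fin K → Fin N → E d => average
        (iterates C (fun _ => 1 / M) (fun j => glf φ (D j)) x₀ (extend Δ) k) :=
      continuous_average.comp (continuous_iterates hproj hg _)
    exact (((hg' j).comp h1).sub ((hg j).comp h1)).const_smul (1 / M)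
  have hpc : ∀ x y : Fin K → Fin N → E d, ∀ k : Fin K, (∀ j < k, x j = y j) → p x k = p y k := by
    intro x y k h
    simp only [p]
    rw [iterates_congr _ fun j hj => ?_]
    have hjK : j < K := hj.trans k.2
    simp only [extend, hjK, dite_true]
    exact h ⟨j, hjK⟩ hj
  have hvc : ∀ x y : Fin K → Fin N → E d, ∀ k : Fin K, (∀ j < k, x j = y j) → v x k = v y k := by
    intro x y k h
    simp only [v, hpc x y k h]
  have hbound : LebesgueBound q (noiseLaw K N d σ) Ψ
      (∏ _k : Fin K, ENNReal.ofReal (Real.exp ((a - 1) * (B₂ / M) ^ 2 / (2 * σ ^ 2)))) := by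
    refine LebesgueBound.pi hq.symm.pos hΨm (fun x y k h => ?_) fun k x => ?_
    · simp only [Ψ, Pi.add_apply]
      rw [h k le_rfl, hvc x y k fun j hj => h j hj.le]
    · have e : ∀ b, Ψ (Function.update x k b) k = b + v x k := fun b => by
        simp only [Ψ, Pi.add_apply, Function.update_self]
        rw [hvc (Function.update x k b) x k fun j hj => Function.update_of_ne hj.ne _ _]
      simp_rw [e]
      refine lebesgueBound_pi_gaussianNoise hq hσ i (fun j hj => ?_) ?_
      · simp [v, hDD' j hj]
      · simp only [v]
        rw [norm_smul, Real.norm_of_nonneg (by positivity), div_mul_eq_mul_div, one_mul]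
        gcongr
        exact hsens i _ (hD' i) _ (hD i) _ (proj_spec hne hC _).1
  have htr : ∀ Δ, transcript C (fun _ => 1 / M) φ x₀ D Δ
      = transcript C (fun _ => 1 / M) φ x₀ D' (Ψ Δ) := fun Δ => by
    funext k
    refine (iterates_shift (n := K) (fun k hk i => ?_) k (Nat.lt_succ_iff.1 k.2)).symm
    simp only [extend, hk, dite_true, Ψ, Pi.add_apply, v, p]
  have htm : Measurable fun Δ : Fin K → Fin N → E d =>
      transcript C (fun _ => 1 / M) φ x₀ D' Δ :=
    (continuous_pi fun k => continuous_iterates hproj hg' _).measurable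
  have key := hbound.measure_preimage_le hq.symm.pos hΨm (htm hS)
  have hset : {Δ : Fin K → Fin N → E d | transcript C (fun _ => 1 / M) φ x₀ D Δ ∈ S}
      = Ψ ⁻¹' ((fun Δ => transcript C (fun _ => 1 / M) φ x₀ D' Δ) ⁻¹' S) := by
    ext Δ
    simp only [Set.mem_ofPred_eq, Set.mem_preimage, htr]
  rw [hset]
  set A := (fun Δ : Fin K → Fin N → E d => transcript C (fun _ => 1 / M) φ x₀ D' Δ) ⁻¹' S
  change _ ≤ _ * noiseLaw K N d σ A + _
  set μ := noiseLaw K N d σ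
  have hqa : 1 / q = 1 - 1 / a := by
    have := hq.inv_add_inv_eq_one
    simp only [one_div]
    linarith
  rw [Finset.prod_const, Finset.card_univ, Fintype.card_fin,
    ← ENNReal.ofReal_pow (Real.exp_pos _).le, ← Real.exp_nat_mul, hqa] at key
  have hexp : (0 : ℝ) ≤ 1 - 1 / a := by rw [← hqa]; exact (one_div_pos.2 hq.symm.pos).le
  rw [← ENNReal.ofReal_toReal (measure_ne_top μ A),
    ENNReal.ofReal_rpow_of_nonneg ENNReal.toReal_nonneg hexp,
    ← ENNReal.ofReal_mul (Real.exp_pos _).le] at key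
  rw [← ENNReal.ofReal_toReal (measure_ne_top μ A), ← ENNReal.ofReal_mul (Real.exp_pos _).le,
    ← ENNReal.ofReal_add (by positivity) hδ.le, ← ENNReal.ofReal_toReal (measure_ne_top μ _)]
  refine ENNReal.ofReal_le_ofReal ?_
  refine le_exp_mul_add_of_le_rpow ENNReal.toReal_nonneg ha hδ
    (ENNReal.toReal_le_of_le_ofReal (by positivity) key) ?_
  have hden : 0 < 1 + 3 * ℓ := by positivity
  have hKB : K * (B₂ / M) ^ 2 = σ ^ 2 * ε ^ 2 / (1 + 3 * ℓ) := by
    rw [hσ2]; field_simp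
  have e1 : K * ((a - 1) * (B₂ / M) ^ 2 / (2 * σ ^ 2)) * a = ℓ * ((ε + 2 * ℓ) / (1 + 3 * ℓ)) := by
    calc _ = (a - 1) * a * (K * (B₂ / M) ^ 2) / (2 * σ ^ 2) := by ring
      _ = _ := by
        rw [hKB]
        simp only [a]
        field_simp
        ring
  -- Here `ε ≤ 1 + log(1/δ)` enters, and explains the factor `1 + 3 ℓ` in `σ²`.
  have e2 : (ε + 2 * ℓ) / (1 + 3 * ℓ) ≤ 1 := (div_le_one hden).2 (by linarith)
  have e3 : ε * (a - 1) = 2 * ℓ := by simp only [a]; field_simp; ring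
  rw [e1, e3]
  nlinarith

end Privacy

end LDPOpt

namespace LDPOpt

/-! ### From averages to the last iterate. -/

section LastIterate

theorem sum_range_le_of_telescope {a b : ℕ → ℝ} {e r : ℝ} {j n : ℕ}
    (h : ∀ i < n, a (j + i + 1) ≤ r + b (j + i) - b (j + i + 1) + e) :
    ∑ i ∈ Finset.range n, a (j + i + 1) ≤ n * (r + e) + b j - b (j + n) := by
  induction n with
  | zero => simp
  | succ n ih =>
    rw [Finset.sum_range_succ]
    have h1 := ih fun i hi => h i (hi.trans n.lt_succ_self)
    have h2 := h n n.lt_succ_self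
    rw [← add_assoc j n 1]
    push_cast
    linarith

theorem sum_range_last (a : ℕ → ℝ) {r K : ℕ} (hr : r ≤ K) :
    ∑ i ∈ Finset.range r, a (K - i) = ∑ i ∈ Finset.range r, a (K - r + i + 1) := by
  rw [← Finset.sum_range_reflect]
  refine Finset.sum_congr rfl fun i hi => ?_
  rw [Finset.mem_range] at hi
  congr 1
  omega

/-- The last iterate is at most logarithmically worse than the average of the last `r` ones. -/
theorem last_le_average {a : ℕ → ℝ} {e : ℝ} (he : 0 ≤ e) {K : ℕ}
    (h : ∀ r ≤ K, ∑ i ∈ Finset.range r, a (K - i) ≤ r * (a (K - r) + e)) {r : ℕ} (hr : 1 ≤ r)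
    (hrK : r ≤ K) : a K ≤ (∑ i ∈ Finset.range r, a (K - i)) / r + e * Real.log r := by
  induction r, hr using Nat.le_induction with
  | base => simp
  | succ r hr ih =>
    have h1 := ih (Nat.le_of_succ_le hrK)
    have h2 := h r (Nat.le_of_succ_le hrK)
    have hr0 : (0 : ℝ) < r := by exact_mod_cast hr
    -- Enlarging the window from `r` to `r + 1` costs `e / (r + 1) ≤ e log((r + 1) / r)`, and these
    -- costs telescope to the logarithm.
    have h3 := Real.one_sub_inv_le_log_of_pos (show (0 : ℝ) < (r + 1) / r by positivity)
    rw [Real.log_div (by positivity) hr0.ne', inv_div] at h3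
    have h4 := mul_le_mul_of_nonneg_left h3 he
    rw [Finset.sum_range_succ]
    set T := ∑ i ∈ Finset.range r, a (K - i)
    push_cast
    have h5 : T / r ≤ (T + a (K - r)) / (r + 1) + e * (1 - r / (r + 1)) := by
      rw [div_add' _ _ _ (by positivity), div_le_div_iff₀ hr0 (by positivity)]
      have : e * (1 - (r : ℝ) / (r + 1)) * (r + 1) = e := by field_simp; ring
      rw [this]
      nlinarith
    nlinarith

/-- Read `a` as suboptimality, `β` and `γ j` as scaled squared distances to the minimizer and to
iterate `j`. By `h1`, `β` contracts down to `e / ρ`, and summing `h1` over a window of `R ≥ 1/ρ`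
rounds bounds the average of `a` there. Using past iterates as comparators, `h2` passes from this
average to the last term at cost `e log R`. The `2 e` is `e` from the average plus `ρ · (e / ρ)`
from `β`. -/
theorem last_iterate_le {a β : ℕ → ℝ} {γ : ℕ → ℕ → ℝ} {e ρ : ℝ} {K R : ℕ} (he : 0 ≤ e)
    (hρ : 0 < ρ) (hρ1 : ρ ≤ 1) (ha : ∀ k, 0 ≤ a k) (hβ : ∀ k, 0 ≤ β k) (hγ : ∀ j k, 0 ≤ γ j k)
    (hγ0 : ∀ j, γ j j = 0) (h1 : ∀ k < K, a (k + 1) ≤ (1 - ρ) * β k - β (k + 1) + e)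
    (h2 : ∀ j k, j ≤ k → k < K → a (k + 1) ≤ a j + γ j k - γ j (k + 1) + e)
    (hR : 1 ≤ ρ * R) (hRK : R ≤ K) :
    a K ≤ e * (2 + Real.log R) + ρ * ((1 - ρ) ^ (K - R) * β 0) := by
  have hR0 : (0 : ℝ) < R := by
    by_contra! h
    nlinarith
  have hR1 : 1 ≤ R := by exact_mod_cast hR0
  have hdecay : ∀ k ≤ K, β k ≤ (1 - ρ) ^ k * β 0 + e / ρ := by
    intro k
    induction k with
    | zero => intro _; simp; positivity
    | succ k ih =>
      intro hk
      have h3 := h1 k hk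
      have h4 := mul_le_mul_of_nonneg_left (ih (Nat.le_of_succ_le hk)) (sub_nonneg.2 hρ1)
      have h5 : (1 - ρ) * (e / ρ) = e / ρ - e := by field_simp
      have h6 := ha (k + 1)
      rw [pow_succ]
      linarith
  have hsum : ∀ r ≤ K, ∑ i ∈ Finset.range r, a (K - i) ≤ r * (a (K - r) + e) := by
    intro r hr
    rw [sum_range_last a hr]
    have := sum_range_le_of_telescope (a := a) (b := γ (K - r)) (e := e) (r := a (K - r))
      (j := K - r) (n := r) fun i hi => h2 _ _ (by omega) (by omega)
    rw [hγ0] at this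
    linarith [hγ (K - r) (K - r + r)]
  have hlast := last_le_average he hsum hR1 hRK
  have havg : (∑ i ∈ Finset.range R, a (K - i)) ≤ R * e + β (K - R) := by
    rw [sum_range_last a hRK]
    have := sum_range_le_of_telescope (a := a) (b := β) (e := e) (r := 0)
      (j := K - R) (n := R) fun i hi => by
        have h3 := h1 (K - R + i) (by omega)
        have h4 := mul_nonneg hρ.le (hβ (K - R + i))
        linarith
    linarith [hβ (K - R + R)]
  have h3 : (∑ i ∈ Finset.range R, a (K - i)) / R ≤ e + ρ * β (K - R) := by
    rw [div_le_iff₀ hR0]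
    nlinarith [hβ (K - R)]
  have h4 := mul_le_mul_of_nonneg_left (hdecay (K - R) (Nat.sub_le _ _)) hρ.le
  have h5 : ρ * (e / ρ) = e := by field_simp
  linarith

end LastIterate

/-! ### One-step regret inequality. -/

section Regret

variable {N d : ℕ} {C : Set (E d)} {φ : ℝ → ℝ → ℝ} {D : Fin N → LocalData d} {m M L C₂ : ℝ}

/-- One step of the projected gradient method with noise `ξ`, compared to a point `u` of `C`. -/
theorem objective_step_sub_le (hN : 0 < N) (hφ : ∀ l, Differentiable ℝ fun s => φ s l)
    (hne : C.Nonempty) (hC : IsClosed C) (hconv : Convex ℝ C) (hM : 0 < M)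
    (hD : ∀ i, Admissible φ C m M L C₂ (D i)) {p u : E d} (hp : p ∈ C) (hu : u ∈ C)
    (ξ : Fin N → E d) {p' : E d}
    (hp' : p' = center C fun i => p - (1 / M) • gradient (glf φ (D i)) p + ξ i) :
    objective φ D p' - objective φ D u
      ≤ N * ((M - m) / 2 * ‖p - u‖ ^ 2 - M / 2 * ‖p' - u‖ ^ 2)
        + M * ∑ i, inner ℝ (ξ i) (p' - u) := by
  have hN' : (0 : ℝ) < N := by exact_mod_cast hN
  have hp'C : p' ∈ C := hp' ▸ (proj_spec hne hC _).1
  have hproj : ∑ i, inner ℝ (p - (1 / M) • gradient (glf φ (D i)) p + ξ i - p') (u - p') ≤ 0 := by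
    have h := inner_sub_proj_nonpos hne hC hconv
      (average fun i => p - (1 / M) • gradient (glf φ (D i)) p + ξ i) hu
    change inner ℝ (_ - center C _) (u - center C _) ≤ 0 at h
    rw [← hp'] at h
    have e : ∑ i, inner ℝ (p - (1 / M) • gradient (glf φ (D i)) p + ξ i - p') (u - p')
        = N * inner ℝ (average (fun i => p - (1 / M) • gradient (glf φ (D i)) p + ξ i) - p')
          (u - p') := by
      rw [← sum_inner, Finset.sum_sub_distrib, ← real_inner_smul_left, average, smul_sub,
        smul_smul, mul_inv_cancel₀ hN'.ne', one_smul]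
      simp [Nat.cast_smul_eq_nsmul]
    rw [e]
    exact mul_nonpos_of_nonneg_of_nonpos hN'.le h
  -- Smoothness from `p` to `p'` and strong convexity from `p` to `u`; with step size `1/M` the term
  -- `‖p' - p‖²` cancels. The last summand has no sign for a single agent, only after summation, by
  -- `hproj`.
  have hterm : ∀ i, glf φ (D i) p' - glf φ (D i) u
      ≤ ((M - m) / 2 * ‖p - u‖ ^ 2 - M / 2 * ‖p' - u‖ ^ 2) + M * inner ℝ (ξ i) (p' - u)
        + M * inner ℝ (p - (1 / M) • gradient (glf φ (D i)) p + ξ i - p') (u - p') := by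
    intro i
    have hd := differentiable_glf hφ (D i)
    have h1 := le_of_smoothGradOn hd hconv (hD i).smooth hp hp'C
    have h2 := le_of_strongConvexGradOn hd hconv (hD i).strongConvex hp hu
    have e1 : M * inner ℝ (p - (1 / M) • gradient (glf φ (D i)) p + ξ i - p') (u - p')
        = M * inner ℝ (p - p') (u - p') - inner ℝ (gradient (glf φ (D i)) p) (u - p')
          + M * inner ℝ (ξ i) (u - p') := by
      rw [show p - (1 / M) • gradient (glf φ (D i)) p + ξ i - p'
        = (p - p') - (1 / M) • gradient (glf φ (D i)) p + ξ i by abel, inner_add_left,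
        inner_sub_left, real_inner_smul_left]
      field_simp
    have e2 : inner ℝ (gradient (glf φ (D i)) p) (u - p')
        = inner ℝ (gradient (glf φ (D i)) p) (u - p)
          - inner ℝ (gradient (glf φ (D i)) p) (p' - p) := by
      rw [← inner_sub_right]; congr 1; abel
    have e3 : inner ℝ (ξ i) (u - p') = -(inner ℝ (ξ i) (p' - u) : ℝ) := by
      rw [← inner_neg_right, neg_sub]
    have e4 : ‖p - u‖ ^ 2 = ‖p' - p‖ ^ 2 + ‖p' - u‖ ^ 2 - 2 * inner ℝ (p - p') (u - p') := by
      have := norm_sub_sq_real (p - p') (u - p')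
      rw [show p - p' - (u - p') = p - u by abel, norm_sub_rev p p', norm_sub_rev u p'] at this
      linarith
    rw [norm_sub_rev u p] at h2
    rw [e1, e2, e3]
    have e5 : M / 2 * ‖p - u‖ ^ 2 = M / 2 * ‖p' - p‖ ^ 2 + M / 2 * ‖p' - u‖ ^ 2
      - M * inner ℝ (p - p') (u - p') := by rw [e4]; ring
    linarith
  have hsum := Finset.sum_le_sum fun i (_ : i ∈ Finset.univ) => hterm i
  rw [Finset.sum_sub_distrib, Finset.sum_add_distrib, Finset.sum_add_distrib, ← Finset.mul_sum,
    ← Finset.mul_sum] at hsum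
  simp only [Finset.sum_const, Finset.card_univ, Fintype.card_fin, nsmul_eq_mul] at hsum
  have := mul_nonpos_of_nonneg_of_nonpos hM.le hproj
  unfold objective
  linarith

end Regret

/-! ### Conditioning on all but one coordinate, as resampling. -/

section Resampling

theorem measurePreserving_update {ι α : Type*} [Fintype ι] [DecidableEq ι] [MeasurableSpace α]
    (μ : Measure α) [IsProbabilityMeasure μ] (k : ι) :
    MeasurePreserving (fun p : (ι → α) × α => Function.update p.1 k p.2)
      ((Measure.pi fun _ => μ).prod μ) (Measure.pi fun _ => μ) := by
  have hm : Measurable fun p : (ι → α) × α => Function.update p.1 k p.2 := by fun_prop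
  refine ⟨hm, (Measure.pi_eq fun s hs => ?_).symm⟩
  rw [Measure.map_apply hm (MeasurableSet.univ_pi hs)]
  have e : (fun p : (ι → α) × α => Function.update p.1 k p.2) ⁻¹' (Set.univ.pi s)
      = (Set.univ.pi (Function.update s k Set.univ)) ×ˢ s k := by
    ext p
    simp only [Set.mem_preimage, Set.mem_pi, Set.mem_univ, true_imp_iff, Set.mem_prod]
    constructor
    · refine fun h => ⟨fun i => ?_, by simpa using h k⟩
      by_cases hi : i = k
      · subst hi; simp
      · simpa [hi] using h i
    · rintro ⟨h, hk⟩ i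
      by_cases hi : i = k
      · subst hi; simpa using hk
      · simpa [hi] using h i
  rw [e, Measure.prod_prod, Measure.pi_pi, ← Finset.mul_prod_erase _ _ (Finset.mem_univ k),
    ← Finset.mul_prod_erase Finset.univ (fun i => μ (s i)) (Finset.mem_univ k),
    Function.update_self, measure_univ, one_mul, mul_comm]
  congr 1
  refine Finset.prod_congr rfl fun i hi => ?_
  rw [Function.update_of_ne (Finset.ne_of_mem_erase hi)]

/-- Redrawing coordinate `k` independently preserves the product law, so a bound on the mean over
that coordinate alone suffices. It serves for the round and then for the agent. -/
theorem integral_pi_le_of_update {ι α : Type*} [Fintype ι] [DecidableEq ι] [MeasurableSpace α]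
    {μ : Measure α} [IsProbabilityMeasure μ] (k : ι) {G : (ι → α) → ℝ}
    (hG : Integrable G (Measure.pi fun _ => μ)) {b : ℝ}
    (h : ∀ x, ∫ r, G (Function.update x k r) ∂μ ≤ b) : ∫ x, G x ∂(Measure.pi fun _ => μ) ≤ b := by
  have hmp := measurePreserving_update μ k
  have hi := hmp.integrable_comp_of_integrable hG
  have e : ∫ x, G x ∂(Measure.pi fun _ => μ)
      = ∫ p : (ι → α) × α, G (Function.update p.1 k p.2) ∂((Measure.pi fun _ => μ).prod μ) := by
    conv_lhs => rw [← hmp.map_eq]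
    rw [integral_map hmp.measurable.aemeasurable]
    rw [hmp.map_eq]
    exact hG.aestronglyMeasurable
  rw [e]
  change ∫ p, (G ∘ fun p : (ι → α) × α => Function.update p.1 k p.2) p ∂_ ≤ b
  rw [integral_prod _ hi]
  calc _ ≤ ∫ _x, b ∂(Measure.pi fun _ => μ) :=
        integral_mono hi.integral_prod_left (integrable_const b) h
    _ = b := by simp

end Resampling

end LDPOpt

namespace LDPOpt

/-- The point `p^k`, the projected average of the vectors exchanged in round `k`. -/
noncomputable def trajectory {K N d : ℕ} (C : Set (E d)) (M : ℝ) (φ : ℝ → ℝ → ℝ)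
    (x₀ : Fin N → E d) (D : Fin N → LocalData d) (Δ : Fin K → Fin N → E d) (k : ℕ) : E d :=
  center C (iterates C (fun _ => 1 / M) (fun i => glf φ (D i)) x₀ (extend Δ) k)

/-! ### Expected suboptimality of the trajectory. -/

section Trajectory

variable {K N d : ℕ} {C : Set (E d)} {M m L C₂ σ : ℝ} {φ : ℝ → ℝ → ℝ}
  {x₀ : Fin N → E d} {D : Fin N → LocalData d}

theorem trajectory_mem (hne : C.Nonempty) (hC : IsClosed C) (Δ : Fin K → Fin N → E d) (k : ℕ) :
    trajectory C M φ x₀ D Δ k ∈ C := (proj_spec hne hC _).1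

theorem trajectory_succ (Δ : Fin K → Fin N → E d) (k : Fin K) :
    trajectory C M φ x₀ D Δ (k + 1) = center C fun i => trajectory C M φ x₀ D Δ k
      - (1 / M) • gradient (glf φ (D i)) (trajectory C M φ x₀ D Δ k) + Δ k i := by
  simp only [trajectory, iterates, extend, k.2, dite_true]

/-- The noise with index `k` first enters point `k + 1`, so `j = k` is still allowed. -/
theorem trajectory_update {k : Fin K} {j : ℕ} (hj : j ≤ k) (Δ : Fin K → Fin N → E d)
    (r : Fin N → E d) :
    trajectory C M φ x₀ D (Function.update Δ k r) j = trajectory C M φ x₀ D Δ j := by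
  unfold trajectory
  rw [iterates_congr _ fun i hi => ?_]
  have hiK : i < K := (hi.trans_le hj).trans k.2
  simp only [extend, hiK, dite_true]
  refine Function.update_of_ne (fun h => ?_) _ _
  rw [← h] at hj
  exact absurd (hi.trans_le hj) (lt_irrefl _)

theorem continuous_trajectory (hne : C.Nonempty) (hC : IsClosed C) (hconv : Convex ℝ C)
    (hM : 0 < M) (hD : ∀ i, Admissible φ C m M L C₂ (D i)) (k : ℕ) :
    Continuous fun Δ : Fin K → Fin N → E d => trajectory C M φ x₀ D Δ k := by
  have hproj := continuous_proj hne hC hconv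
  exact hproj.comp (continuous_average.comp (continuous_iterates hproj
    (fun i => continuous_gradient_proj hne hC hconv hM (hD i)) k))

theorem integrable_of_continuous_of_mem (hC : IsClosed C)
    (hb : Bornology.IsBounded C) {X : Type*} [TopologicalSpace X] [MeasurableSpace X]
    [OpensMeasurableSpace X] {μ : Measure X} [IsFiniteMeasure μ] {u v : X → E d}
    (hu : Continuous u) (huC : ∀ x, u x ∈ C) (hv : Continuous v) (hvC : ∀ x, v x ∈ C)
    {H : E d → E d → ℝ} (hH : Continuous fun p : E d × E d => H p.1 p.2) :
    Integrable (fun x => H (u x) (v x)) μ := by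
  have hcomp := (Metric.isCompact_of_isClosed_isBounded hC hb)
  obtain ⟨B, hB⟩ := (hcomp.prod hcomp).exists_bound_of_continuousOn hH.continuousOn
  refine Integrable.of_bound (hH.comp (hu.prodMk hv)).aestronglyMeasurable B
    (Filter.Eventually.of_forall fun x => hB (u x, v x) ⟨huC x, hvC x⟩)

theorem integrable_norm_noiseLaw (k : Fin K) (i : Fin N) :
    Integrable (fun Δ : Fin K → Fin N → E d => ‖Δ k i‖) (noiseLaw K N d σ) := by
  have h1 : Integrable (fun r : Fin N → E d => ‖r i‖) (Measure.pi fun _ => gaussianNoise d σ) :=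
    integrable_comp_eval (i := i) (integrable_norm_gaussianNoise σ)
  exact integrable_comp_eval (μ := fun _ : Fin K => Measure.pi fun _ : Fin N => gaussianNoise d σ)
    (i := k) h1

theorem isBounded_of_admissible {P : LocalData d} (hφ : ∀ l, Differentiable ℝ fun s => φ s l)
    (hconv : Convex ℝ C) (hm : 0 < m) (hL : 0 < L) (hP : Admissible φ C m M L C₂ P) :
    Bornology.IsBounded C :=
  Metric.isBounded_iff.2 ⟨2 * L * C₂ / m, fun x hx y hy => by
    rw [dist_eq_norm]; exact norm_sub_le_of_admissible hφ hconv hm hL hP hx hy⟩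

theorem integrable_inner_noise (hφ : ∀ l, Differentiable ℝ fun s => φ s l) (hne : C.Nonempty)
    (hC : IsClosed C) (hconv : Convex ℝ C) (hm : 0 < m) (hM : 0 < M) (hL : 0 < L)
    (hD : ∀ i, Admissible φ C m M L C₂ (D i)) (k : Fin K) (i : Fin N)
    {u : (Fin K → Fin N → E d) → E d} (hu : Continuous u) (huC : ∀ Δ, u Δ ∈ C) :
    Integrable (fun Δ => inner ℝ (Δ k i) (trajectory C M φ x₀ D Δ (k + 1) - u Δ))
      (noiseLaw K N d σ) := by
  refine ((integrable_norm_noiseLaw k i).mul_const (2 * L * C₂ / m)).mono'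
    (Continuous.aestronglyMeasurable ?_) (Filter.Eventually.of_forall fun Δ => ?_)
  · have := continuous_trajectory (K := K) (x₀ := x₀) hne hC hconv hM hD (k + 1)
    have h2 : Continuous fun Δ : Fin K → Fin N → E d => Δ k i := by fun_prop
    exact h2.inner (this.sub hu)
  · refine (norm_inner_le_norm _ _).trans ?_
    gcongr
    exact norm_sub_le_of_admissible hφ hconv hm hL (hD i) (trajectory_mem hne hC _ _) (huC Δ)

/-- With all noise but `Δ k i` frozen, `u` is fixed and the next point is the projection of a
constant plus `Δ k i / N`: the situation of the Gaussian correlation bound with `s = 1/N`. -/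
theorem integral_inner_noise_le (hφ : ∀ l, Differentiable ℝ fun s => φ s l) (hne : C.Nonempty)
    (hC : IsClosed C) (hconv : Convex ℝ C) (hm : 0 < m) (hM : 0 < M) (hL : 0 < L) (hσ : 0 < σ)
    (hD : ∀ i, Admissible φ C m M L C₂ (D i)) (k : Fin K) (i : Fin N)
    {u : (Fin K → Fin N → E d) → E d} (hu : Continuous u) (huC : ∀ Δ, u Δ ∈ C)
    (huk : ∀ Δ r, u (Function.update Δ k r) = u Δ) :
    ∫ Δ, inner ℝ (Δ k i) (trajectory C M φ x₀ D Δ (k + 1) - u Δ) ∂(noiseLaw K N d σ)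
      ≤ σ * (L * C₂ / m) := by
  refine integral_pi_le_of_update k
    (integrable_inner_noise hφ hne hC hconv hm hM hL hD k i hu huC) fun Δ => ?_
  simp only [huk, trajectory_succ, Function.update_self, trajectory_update le_rfl]
  set p := trajectory C M φ x₀ D Δ k
  let w : Fin N → E d := fun i => p - (1 / M) • gradient (glf φ (D i)) p
  change ∫ r : Fin N → E d, inner ℝ (r i) (center C (fun i => w i + r i) - u Δ) ∂_ ≤ _
  have hcont : Continuous fun r : Fin N → E d => center C (fun i => w i + r i) :=
    (continuous_proj hne hC hconv).comp (continuous_average.comp (by fun_prop))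
  have hint : Integrable (fun r : Fin N → E d =>
      inner ℝ (r i) (center C (fun i => w i + r i) - u Δ))
      (Measure.pi fun _ => gaussianNoise d σ) := by
    have h1 : Integrable (fun r : Fin N → E d => ‖r i‖) (Measure.pi fun _ => gaussianNoise d σ) :=
      integrable_comp_eval (i := i) (integrable_norm_gaussianNoise σ)
    refine (h1.mul_const (2 * L * C₂ / m)).mono' (Continuous.aestronglyMeasurable ?_)
      (Filter.Eventually.of_forall fun r => ?_)
    · have h2 : Continuous fun r : Fin N → E d => r i := by fun_prop
      exact h2.inner (hcont.sub continuous_const)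
    · refine (norm_inner_le_norm _ _).trans ?_
      gcongr
      exact norm_sub_le_of_admissible hφ hconv hm hL (hD i) (proj_spec hne hC _).1 (huC Δ)
  refine integral_pi_le_of_update i hint fun r => ?_
  have hN : (0 : ℝ) < N := by exact_mod_cast i.pos
  have e : ∀ x : E d, center C (fun j => w j + Function.update r i x j)
      = proj C ((N : ℝ)⁻¹ • (∑ j, w j + ∑ j ∈ Finset.univ \ {i}, r j) + (N : ℝ)⁻¹ • x) := by
    intro x
    simp only [center, average]
    rw [Finset.sum_add_distrib, Finset.sum_update_of_mem (Finset.mem_univ i), ← smul_add]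
    congr 2
    abel
  simp only [e, Function.update_self]
  exact integral_inner_proj_gaussianNoise_le hφ hne hC hconv hm hM hL (hD i) _ _
    (inv_pos.2 hN) hσ

theorem continuous_objective (hφ : ∀ l, Differentiable ℝ fun s => φ s l) :
    Continuous (objective φ D) :=
  continuous_finsetSum _ fun i _ => (differentiable_glf hφ (D i)).continuous

theorem integrable_objective_trajectory (hN : 0 < N) (hφ : ∀ l, Differentiable ℝ fun s => φ s l)
    (hne : C.Nonempty) (hC : IsClosed C) (hconv : Convex ℝ C) (hm : 0 < m) (hM : 0 < M)
    (hL : 0 < L) (hD : ∀ i, Admissible φ C m M L C₂ (D i)) (k : ℕ) :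
    Integrable (fun Δ : Fin K → Fin N → E d => objective φ D (trajectory C M φ x₀ D Δ k))
      (noiseLaw K N d σ) := by
  have hc := continuous_trajectory (K := K) (x₀ := x₀) hne hC hconv hM hD k
  have hm := fun Δ : Fin K → Fin N → E d => trajectory_mem (M := M) (φ := φ) (x₀ := x₀) (D := D)
    hne hC Δ k
  exact integrable_of_continuous_of_mem hC
    (isBounded_of_admissible hφ hconv ‹0 < m› hL (hD ⟨0, hN⟩)) hc hm hc hm
    (H := fun x _ => objective φ D x) ((continuous_objective hφ).comp continuous_fst)

theorem integral_objective_step_sub_le (hN : 0 < N) (hφ : ∀ l, Differentiable ℝ fun s => φ s l)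
    (hne : C.Nonempty) (hC : IsClosed C) (hconv : Convex ℝ C) (hm : 0 < m) (hM : 0 < M)
    (hL : 0 < L) (hσ : 0 < σ) (hD : ∀ i, Admissible φ C m M L C₂ (D i)) (k : Fin K)
    {u : (Fin K → Fin N → E d) → E d} (hu : Continuous u) (huC : ∀ Δ, u Δ ∈ C)
    (huk : ∀ Δ r, u (Function.update Δ k r) = u Δ) :
    ∫ Δ, objective φ D (trajectory C M φ x₀ D Δ (k + 1)) ∂(noiseLaw K N d σ)
        - ∫ Δ, objective φ D (u Δ) ∂(noiseLaw K N d σ)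
      ≤ N * ((M - m) / 2 * ∫ Δ, ‖trajectory C M φ x₀ D Δ k - u Δ‖ ^ 2 ∂(noiseLaw K N d σ)
          - M / 2 * ∫ Δ, ‖trajectory C M φ x₀ D Δ (k + 1) - u Δ‖ ^ 2 ∂(noiseLaw K N d σ))
        + N * (M * (σ * (L * C₂ / m))) := by
  set μ := noiseLaw K N d σ
  have hb := isBounded_of_admissible hφ hconv hm hL (hD ⟨0, hN⟩)
  have hc := fun k => continuous_trajectory (K := K) (x₀ := x₀) hne hC hconv hM hD k
  have hmem := fun k (Δ : Fin K → Fin N → E d) => trajectory_mem (M := M) (φ := φ) (x₀ := x₀)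
    (D := D) hne hC Δ k
  have hsq : ∀ k : ℕ, Integrable (fun Δ => ‖trajectory C M φ x₀ D Δ k - u Δ‖ ^ 2) μ := fun k =>
    integrable_of_continuous_of_mem hC hb (hc k) (hmem k) hu huC
      (H := fun x y => ‖x - y‖ ^ 2) (by fun_prop)
  have hF : Integrable (fun Δ => objective φ D (u Δ)) μ :=
    integrable_of_continuous_of_mem hC hb hu huC hu huC
    (H := fun x _ => objective φ D x) ((continuous_objective hφ).comp continuous_fst)
  have hF' := integrable_objective_trajectory (x₀ := x₀) (σ := σ) (K := K) hN hφ hne hC hconv hm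
    hM hL hD (k + 1)
  have hin := fun i => integrable_inner_noise (x₀ := x₀) (σ := σ) hφ hne hC hconv hm hM hL hD k i
    hu huC
  rw [← integral_sub hF' hF]
  have i1 : Integrable (fun Δ => (M - m) / 2 * ‖trajectory C M φ x₀ D Δ k - u Δ‖ ^ 2
      - M / 2 * ‖trajectory C M φ x₀ D Δ (k + 1) - u Δ‖ ^ 2) μ := ((hsq k).const_mul ((M - m) / 2)).sub ((hsq (k + 1)).const_mul (M / 2))
  have i2 := (integrable_finsetSum Finset.univ fun i _ => hin i).const_mul M
  calc _ ≤ ∫ Δ, (N * ((M - m) / 2 * ‖trajectory C M φ x₀ D Δ k - u Δ‖ ^ 2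
          - M / 2 * ‖trajectory C M φ x₀ D Δ (k + 1) - u Δ‖ ^ 2)
          + M * ∑ i, inner ℝ (Δ k i) (trajectory C M φ x₀ D Δ (k + 1) - u Δ)) ∂μ :=
        integral_mono (hF'.sub hF) ((i1.const_mul (N : ℝ)).add i2) fun Δ =>
          objective_step_sub_le hN hφ hne hC hconv hM hD (hmem k Δ) (huC Δ) (Δ k)
            (trajectory_succ Δ k)
    _ ≤ _ := by
        rw [integral_add (i1.const_mul (N : ℝ)) i2, integral_const_mul, integral_const_mul,
          integral_sub ((hsq k).const_mul _) ((hsq (k + 1)).const_mul _), integral_const_mul,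
          integral_const_mul, integral_finsetSum _ fun i _ => hin i]
        refine add_le_add le_rfl ?_
        calc _ ≤ M * ∑ _i : Fin N, σ * (L * C₂ / m) := by
              gcongr with i
              exact integral_inner_noise_le hφ hne hC hconv hm hM hL hσ hD k i hu huC huk
          _ = _ := by simp; ring

/-- The expected suboptimality of the final estimate, for an arbitrary number of rounds. -/
theorem integral_objective_finalEstimate_sub_le (hN : 0 < N)
    (hφ : ∀ l, Differentiable ℝ fun s => φ s l) (hne : C.Nonempty) (hC : IsClosed C)
    (hconv : Convex ℝ C) (hm : 0 < m) (hmM : m ≤ M) (hL : 0 < L) (hσ : 0 < σ)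
    (hD : ∀ i, Admissible φ C m M L C₂ (D i)) {xs : E d} (hxs : xs ∈ C)
    (hmin : IsMinOn (objective φ D) C xs) {R : ℕ} (hR : 1 ≤ m / M * R) (hRK : R ≤ K) :
    ∫ Δ, objective φ D (trajectory C M φ x₀ D Δ K) ∂(noiseLaw K N d σ) - objective φ D xs
      ≤ N * (M * (σ * (L * C₂ / m)) * (2 + Real.log R)
        + m / 2 * ((1 - m / M) ^ (K - R) * (2 * L * C₂ / m) ^ 2)) := by
  have hM : 0 < M := hm.trans_le hmM
  have hN' : (0 : ℝ) < N := by exact_mod_cast hN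
  have hC₂ : 0 ≤ C₂ := (norm_nonneg _).trans ((hD ⟨0, hN⟩).norm_le ⟨0, (D ⟨0, hN⟩).b_pos⟩)
  set μ := noiseLaw K N d σ with hμ
  set e := M * (σ * (L * C₂ / m)) with he
  have hc := fun k => continuous_trajectory (K := K) (x₀ := x₀) hne hC hconv hM hD k
  have hmem := fun k (Δ : Fin K → Fin N → E d) => trajectory_mem (M := M) (φ := φ) (x₀ := x₀)
    (D := D) hne hC Δ k
  have hF := fun k => integrable_objective_trajectory (x₀ := x₀) (σ := σ) (K := K) hN hφ hne hC
    hconv hm hM hL hD k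
  let a : ℕ → ℝ := fun k =>
    (∫ Δ, objective φ D (trajectory C M φ x₀ D Δ k) ∂μ - objective φ D xs) / N
  let β : ℕ → ℝ := fun k => M / 2 * ∫ Δ, ‖trajectory C M φ x₀ D Δ k - xs‖ ^ 2 ∂μ
  let γ : ℕ → ℕ → ℝ := fun j k => M / 2 *
    ∫ Δ, ‖trajectory C M φ x₀ D Δ k - trajectory C M φ x₀ D Δ j‖ ^ 2 ∂μ
  have key : a K ≤ e * (2 + Real.log R) + m / M * ((1 - m / M) ^ (K - R) * β 0) := by
    refine last_iterate_le (β := β) (γ := γ) (by positivity) (by positivity)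
      ((div_le_one hM).2 hmM) (fun k => ?_) (fun k => ?_) (fun j k => ?_) (fun j => ?_)
      (fun k hk => ?_) (fun j k hjk hk => ?_) hR hRK
    · refine div_nonneg (sub_nonneg.2 ?_) hN'.le
      calc objective φ D xs = ∫ _Δ, objective φ D xs ∂μ := by simp
        _ ≤ _ := integral_mono (integrable_const _) (hF k) fun Δ => hmin (hmem k Δ)
    · exact mul_nonneg (by positivity) (integral_nonneg fun _ => by positivity)
    · exact mul_nonneg (by positivity) (integral_nonneg fun _ => by positivity)
    · simp [γ]
    · have h := integral_objective_step_sub_le (x₀ := x₀) (σ := σ) hN hφ hne hC hconv hm hM hL hσ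
        hD ⟨k, hk⟩ (u := fun _ => xs) continuous_const (fun _ => hxs) (fun _ _ => rfl)
      simp only [integral_const, probReal_univ, one_smul] at h
      simp only [a]
      rw [div_le_iff₀ hN']
      have e1 : (1 - m / M) * β k
          = (M - m) / 2 * ∫ Δ, ‖trajectory C M φ x₀ D Δ k - xs‖ ^ 2 ∂μ := by
        simp only [β]; field_simp
      rw [e1]
      simp only [β]
      linarith
    -- The comparator is the earlier iterate `j ≤ k`, random but independent of the noise of round
    -- `k`; the gain from strong convexity is dropped.
    · have h := integral_objective_step_sub_le (x₀ := x₀) (σ := σ) hN hφ hne hC hconv hm hM hL hσ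
        hD ⟨k, hk⟩ (u := fun Δ => trajectory C M φ x₀ D Δ j) (hc j) (hmem j)
        (fun Δ r => trajectory_update hjk Δ r)
      have h0 : 0 ≤ ∫ Δ, ‖trajectory C M φ x₀ D Δ k - trajectory C M φ x₀ D Δ j‖ ^ 2 ∂μ :=
        integral_nonneg fun _ => by positivity
      have h1 := mul_nonneg hN'.le (mul_nonneg (by positivity : 0 ≤ m / 2) h0)
      simp only [a, γ]
      rw [div_le_iff₀ hN', add_mul, sub_mul, add_mul, div_mul_cancel₀ _ hN'.ne']
      simp only at h
      linarith
  -- The starting point is projected onto `C` as well, so the diameter of `C` replaces any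
  -- dependence on `x₀`.
  have hβ0 : β 0 ≤ M / 2 * (2 * L * C₂ / m) ^ 2 := by
    refine mul_le_mul_of_nonneg_left ?_ (by positivity)
    calc _ ≤ ∫ _Δ, (2 * L * C₂ / m) ^ 2 ∂μ := by
          refine integral_mono_of_nonneg (Filter.Eventually.of_forall fun _ => by positivity)
            (integrable_const _) (Filter.Eventually.of_forall fun Δ => ?_)
          exact pow_le_pow_left₀ (norm_nonneg _) (norm_sub_le_of_admissible hφ hconv hm hL
            (hD ⟨0, hN⟩) (hmem 0 Δ) hxs) 2
      _ = _ := by simp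
  have h1 : 0 ≤ 1 - m / M := sub_nonneg.2 ((div_le_one hM).2 hmM)
  simp only [a] at key
  rw [div_le_iff₀ hN'] at key
  refine key.trans ?_
  rw [mul_comm]
  refine mul_le_mul_of_nonneg_left (add_le_add le_rfl ?_) hN'.le
  calc m / M * ((1 - m / M) ^ (K - R) * β 0)
      ≤ m / M * ((1 - m / M) ^ (K - R) * (M / 2 * (2 * L * C₂ / m) ^ 2)) := by gcongr
    _ = _ := by field_simp

end Trajectory

end LDPOpt

namespace LDPOpt

/-! ### Numerical estimates for the chosen parameters. -/

section Parameters

theorem one_le_log_of_three_le {x : ℝ} (hx : 3 ≤ x) : 1 ≤ Real.log x := by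
  rw [Real.le_log_iff_exp_le (by linarith)]
  linarith [Real.exp_one_lt_d9]

/-- Used with `A = L C₂ B₂`, `x = M/m` and `k` the number of rounds. As `1 + 3 ℓ ≤ 4 Λ`, the
radicand is at most `20 Λ² x ≤ (5 Λ)² x`. -/
theorem noise_le {m M A ε x Λ ℓ k : ℝ} (hM : 0 < M) (hm : 0 < m) (hA : 0 ≤ A) (hε : 0 < ε)
    (hx : 0 ≤ x) (hk : k ≤ 5 * Λ * x) (hℓ0 : 0 ≤ ℓ) (hℓ : ℓ ≤ Λ) (hΛ : 1 ≤ Λ) :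
    A / M * Real.sqrt (k * (1 + 3 * ℓ)) / ε * M / m ≤ 5 * Λ * (Real.sqrt x * A / (m * ε)) := by
  have h1 : Real.sqrt (k * (1 + 3 * ℓ)) ≤ 5 * Λ * Real.sqrt x := by
    refine Real.sqrt_le_iff.2 ⟨by positivity, ?_⟩
    rw [mul_pow, Real.sq_sqrt hx]
    calc k * (1 + 3 * ℓ) ≤ 5 * Λ * x * (4 * Λ) :=
          mul_le_mul hk (by linarith) (by positivity) (by positivity)
      _ ≤ _ := by nlinarith [mul_nonneg (sq_nonneg Λ) hx]
  calc A / M * Real.sqrt (k * (1 + 3 * ℓ)) / ε * M / m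
      = A / (m * ε) * Real.sqrt (k * (1 + 3 * ℓ)) := by field_simp
    _ ≤ A / (m * ε) * (5 * Λ * Real.sqrt x) := by gcongr
    _ = _ := by ring

/-- After `n` rounds the initial error has shrunk by `exp(-2 log Q) = Q⁻²`, and `Q² ≥ G ε / B₂`
because `Q ≥ G / B₂` and `Q ≥ 1/δ ≥ ε`. -/
theorem bias_le {m M G B₂ ε δ Q Λ : ℝ} {n : ℕ} (hm : 0 < m) (hmM : m ≤ M) (hG : 0 < G)
    (hB : 0 < B₂) (hδ : 0 < δ) (hε : 0 < ε) (hεδ : ε ≤ 1 + Real.log (1 / δ))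
    (hQG : G / B₂ ≤ Q) (hQδ : 1 / δ ≤ Q) (hQ0 : 0 < Q) (hQ : Λ = Real.log Q)
    (hn : 2 * Λ * (M / m) ≤ n) :
    m / 2 * ((1 - m / M) ^ n * (2 * G / m) ^ 2) ≤ 2 * (G * B₂ / (m * ε)) := by
  have hM := hm.trans_le hmM
  have h1 : (1 - m / M) ^ n ≤ (Q ^ 2)⁻¹ := by
    have h2 : 1 - m / M ≤ Real.exp (-(m / M)) := by
      linarith [Real.add_one_le_exp (-(m / M))]
    calc (1 - m / M) ^ n ≤ Real.exp (-(m / M)) ^ n :=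
          pow_le_pow_left₀ (sub_nonneg.2 ((div_le_one hM).2 hmM)) h2 n
      _ = Real.exp (-(m / M * n)) := by rw [← Real.exp_nat_mul]; congr 1; ring
      _ ≤ Real.exp (-(2 * Λ)) := by
          refine Real.exp_le_exp.2 (neg_le_neg ?_)
          calc 2 * Λ = m / M * (2 * Λ * (M / m)) := by field_simp
            _ ≤ _ := by gcongr
      _ = (Q ^ 2)⁻¹ := by
          rw [Real.exp_neg, hQ, mul_comm, Real.exp_mul, Real.exp_log hQ0]
          norm_num
  have h3 : (Q ^ 2)⁻¹ ≤ B₂ / (G * ε) := by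
    have h4 : ε ≤ 1 / δ := by
      have := Real.log_le_sub_one_of_pos (one_div_pos.2 hδ)
      linarith
    rw [← inv_div]
    refine inv_anti₀ (by positivity) ?_
    calc G * ε / B₂ = G / B₂ * ε := by ring
      _ ≤ Q * Q := mul_le_mul hQG (h4.trans hQδ) hε.le hQ0.le
      _ = Q ^ 2 := by ring
  calc m / 2 * ((1 - m / M) ^ n * (2 * G / m) ^ 2)
      ≤ m / 2 * (B₂ / (G * ε) * (2 * G / m) ^ 2) := by
        gcongr
        exact h1.trans h3
    _ = _ := by field_simp

/-- The conditions hold on `C` only, so `M < m` is not contradictory; it forces `C` to be a single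
point. -/
theorem eq_of_admissible_of_lt {d : ℕ} {C : Set (E d)} {φ : ℝ → ℝ → ℝ} {m M L C₂ : ℝ}
    {P : LocalData d} (hMm : M < m) (hP : Admissible φ C m M L C₂ P) {x y : E d} (hx : x ∈ C)
    (hy : y ∈ C) : x = y := by
  have h1 := hP.strongConvex x hx y hy
  have h2 := mul_le_mul_of_nonneg_left (hP.smooth x hx y hy) (norm_nonneg (x - y))
  have h3 := real_inner_le_norm (x - y) (gradient (glf φ P) x - gradient (glf φ P) y)
  have h4 : (m - M) * ‖x - y‖ ^ 2 ≤ 0 := by nlinarith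
  have h5 : ‖x - y‖ ^ 2 ≤ 0 := nonpos_of_mul_nonpos_right h4 (sub_pos.2 hMm)
  rw [← sub_eq_zero, ← norm_eq_zero]
  exact pow_eq_zero_iff two_ne_zero |>.1 (le_antisymm h5 (sq_nonneg _))

end Parameters

end LDPOpt

theorem theorem4p1 :
    ∃ (c : ℝ) (p : ℕ), ∀ (N : ℕ) (m M L C₂ B₂ ε δ : ℝ),
      0 < N → 0 < m → 0 < M → 0 < L → 0 < C₂ → 0 < B₂ →
      0 < δ → δ < 1 → 0 < ε → ε ≤ 1 + Real.log (1 / δ) →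
      -- the number of rounds and the noise level depend on these constants only
      ∃ (K : ℕ) (σ : ℝ), 0 < σ ∧
        ∀ (d : ℕ) (C : Set (LDPOpt.E d)) (φ : ℝ → ℝ → ℝ)
          (𝓕 : Fin N → Set (LDPOpt.LocalData d)) (x₀ : Fin N → LDPOpt.E d),
          C.Nonempty → IsClosed C → Convex ℝ C →
          (∀ l, ConvexOn ℝ Set.univ fun s => φ s l) →
          (∀ l, Differentiable ℝ fun s => φ s l) →
          (∀ i, ∀ P ∈ 𝓕 i, LDPOpt.Admissible φ C m M L C₂ P) →
          (∀ i, LDPOpt.SensitivityLE φ C B₂ (𝓕 i)) →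
          LDPOpt.IsLDP (LDPOpt.noiseLaw K N d σ)
              (fun D => LDPOpt.transcript C (fun _ => 1 / M) φ x₀ D) 𝓕 ε δ ∧
          ∀ D : Fin N → LDPOpt.LocalData d, (∀ i, D i ∈ 𝓕 i) →
            ∀ xs ∈ C, IsMinOn (LDPOpt.objective φ D) C xs →
              MeasureTheory.Integrable (fun Δ => LDPOpt.objective φ D
                  (LDPOpt.finalEstimate C (fun _ => 1 / M) φ x₀ D Δ))
                (LDPOpt.noiseLaw K N d σ) ∧
              (∫ Δ, LDPOpt.objective φ D
                  (LDPOpt.finalEstimate C (fun _ => 1 / M) φ x₀ D Δ)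
                ∂(LDPOpt.noiseLaw K N d σ)) - LDPOpt.objective φ D xs
                ≤ c * (Real.sqrt M * N * C₂ * L * B₂ / (m ^ (3 / 2 : ℝ) * ε))
                  * Real.log (2 + M / m + L * C₂ / B₂ + 1 / δ) ^ p := by
  -- `17 = 5 · 3 + 2`: noise `5 Λ X` times `2 + log R ≤ 3 Λ`, plus bias `2 X`.
  refine ⟨17, 2, fun N m M L C₂ B₂ ε δ hN hm hM hL hC₂ hB₂ hδ hδ1 hε hεδ => ?_⟩
  have hδ' : 1 < 1 / δ := (one_lt_div hδ).2 hδ1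
  have hx0 : 0 < M / m := div_pos hM hm
  have hG0 : 0 < L * C₂ / B₂ := by positivity
  set ℓ := Real.log (1 / δ) with hℓdef
  have hℓ : 0 < ℓ := Real.log_pos hδ'
  set Q := 2 + M / m + L * C₂ / B₂ + 1 / δ with hQ
  have hQ3 : 3 ≤ Q := by linarith
  set Λ := Real.log Q with hΛdef
  have hΛ : 1 ≤ Λ := LDPOpt.one_le_log_of_three_le hQ3
  have hℓΛ : ℓ ≤ Λ := Real.log_le_log (by positivity) (by linarith)
  -- `R` is the final averaging window, long enough for `(m/M) R ≥ 1`; the first `T` rounds reduce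
  -- the initial error.
  let R : ℕ := ⌈M / m⌉₊
  let T : ℕ := ⌈2 * Λ * (M / m)⌉₊
  let K : ℕ := R + T
  have hR1 : 1 ≤ R := Nat.one_le_iff_ne_zero.2 (Nat.ceil_pos.2 hx0).ne'
  have hR1' : (1 : ℝ) ≤ R := by exact_mod_cast hR1
  have hK0 : (0 : ℝ) < K := by
    have : 1 ≤ K := hR1.trans (Nat.le_add_right _ _)
    exact_mod_cast this
  let σ : ℝ := B₂ / M * Real.sqrt (K * (1 + 3 * ℓ)) / ε
  have hσ : 0 < σ := by positivity
  have hσ2 : σ ^ 2 = K * (B₂ / M) ^ 2 * (1 + 3 * ℓ) / ε ^ 2 := by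
    simp only [σ]
    rw [div_pow, mul_pow, Real.sq_sqrt (by positivity)]
    ring
  refine ⟨K, σ, hσ, fun d C φ 𝓕 x₀ hne hC hconv _ hφ hadm hsens =>
    ⟨LDPOpt.isLDP_transcript hne hC hconv hM hδ hδ1 hε hεδ hσ hσ2 hadm hsens,
      fun D hD xs hxs hmin => ?_⟩⟩
  have hDa := fun i => hadm i _ (hD i)
  have hfin : ∀ Δ : Fin K → Fin N → LDPOpt.E d,
      LDPOpt.finalEstimate C (fun _ => 1 / M) φ x₀ D Δ = LDPOpt.trajectory C M φ x₀ D Δ K :=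
    fun _ => rfl
  simp only [hfin]
  refine ⟨LDPOpt.integrable_objective_trajectory hN hφ hne hC hconv hm hM hL hDa K, ?_⟩
  have hX : Real.sqrt M * N * C₂ * L * B₂ / (m ^ (3 / 2 : ℝ) * ε)
      = N * (Real.sqrt (M / m) * (L * C₂ * B₂) / (m * ε)) := by
    have e : m ^ (3 / 2 : ℝ) = m * Real.sqrt m := by
      rw [show (3 / 2 : ℝ) = 1 + 1 / 2 by norm_num, Real.rpow_add hm, Real.rpow_one,
        ← Real.sqrt_eq_rpow]
    rw [e, Real.sqrt_div hM.le]
    have := Real.sqrt_pos.2 hm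
    field_simp
  rw [hX]
  set X := Real.sqrt (M / m) * (L * C₂ * B₂) / (m * ε) with hXdef
  have hX0 : 0 ≤ X := by positivity
  rcases lt_or_ge M m with hMm | hmM
  · have h : ∀ Δ : Fin K → Fin N → LDPOpt.E d, LDPOpt.trajectory C M φ x₀ D Δ K = xs := fun Δ =>
      LDPOpt.eq_of_admissible_of_lt hMm (hDa ⟨0, hN⟩) (LDPOpt.trajectory_mem hne hC Δ K) hxs
    simp only [h, MeasureTheory.integral_const, MeasureTheory.probReal_univ, one_smul, sub_self]
    positivity
  have hx1 : 1 ≤ M / m := (one_le_div hm).2 hmM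
  have hRlt : (R : ℝ) < M / m + 1 := Nat.ceil_lt_add_one hx0.le
  have hTlt : (T : ℝ) < 2 * Λ * (M / m) + 1 := Nat.ceil_lt_add_one (by positivity)
  have hRge : M / m ≤ R := Nat.le_ceil _
  have hTge : 2 * Λ * (M / m) ≤ T := Nat.le_ceil _
  have hmain := LDPOpt.integral_objective_finalEstimate_sub_le (x₀ := x₀) (K := K) (R := R) hN hφ
    hne hC hconv hm hmM hL hσ hDa hxs hmin
    (by
      calc (1 : ℝ) = m / M * (M / m) := by field_simp
        _ ≤ _ := by gcongr) (Nat.le_add_right _ _)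
  refine hmain.trans ?_
  have hKT : K - R = T := Nat.add_sub_cancel_left _ _
  have hK : (K : ℝ) ≤ 5 * Λ * (M / m) := by
    have : (K : ℝ) = R + T := by simp only [K]; push_cast; ring
    rw [this]
    nlinarith
  have hnoise : M * (σ * (L * C₂ / m)) ≤ 5 * Λ * X := by
    have h := LDPOpt.noise_le (A := L * C₂ * B₂) hM hm (by positivity) hε hx0.le hK hℓ.le hℓΛ hΛ
    refine le_trans (le_of_eq ?_) h
    simp only [σ]
    ring
  have hlogR : Real.log R ≤ Λ := Real.log_le_log (by linarith) (by linarith)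
  have hlogR0 : 0 ≤ Real.log R := Real.log_nonneg hR1'
  have hbias := LDPOpt.bias_le (n := T) hm hmM (mul_pos hL hC₂) hB₂ hδ hε hεδ
    (show L * C₂ / B₂ ≤ Q by linarith) (by linarith) (by linarith) hΛdef hTge
  have hbX : L * C₂ * B₂ / (m * ε) ≤ X := by
    exact div_le_div_of_nonneg_right
      (le_mul_of_one_le_left (by positivity) (Real.one_le_sqrt.2 hx1)) (by positivity)
  have h1 : M * (σ * (L * C₂ / m)) * (2 + Real.log R) ≤ 5 * Λ * X * (3 * Λ) :=
    mul_le_mul hnoise (by linarith) (by linarith) (by positivity)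
  have h2 : X ≤ X * Λ ^ 2 := le_mul_of_one_le_right hX0 (one_le_pow₀ hΛ)
  rw [hKT, show (2 : ℝ) * L * C₂ = 2 * (L * C₂) by ring]
  calc (N : ℝ) * (M * (σ * (L * C₂ / m)) * (2 + Real.log R)
        + m / 2 * ((1 - m / M) ^ T * (2 * (L * C₂) / m) ^ 2))
      ≤ N * (5 * Λ * X * (3 * Λ) + 2 * (X * Λ ^ 2)) := by
        refine mul_le_mul_of_nonneg_left ?_ (Nat.cast_nonneg N)
        linarith
    _ = _ := by ring
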